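/- **Setting.** Let $V$ be a finite set, $K\colon V^2\to[0,1]$ a matrix with $\sum_{y}K(x,y)\le 1$ for all $x$, no principal sub-matrix of which is stochastic, let $\lambda\in(0,\infty)$, and let $\nu$ be a probability distribution on $V$ such that every site can be reached from the support of $\nu$ by a path along which $K>0$. In the Activated Random Walk (ARW) dynamics on configurations in $\{0,\mathrm{s},1,2,\dots\}^V$ ($0$: empty site; $\mathrm s$: one sleeping particle; $k\ge1$: $k$ active particles), each active particle at $x$ independently jumps to $y$ at rate $K(x,y)$, dies at rate $1-\sum_yK(x,y)$, and falls asleep at rate $\lambda$ when alone on its site; a sleeping particle becomes active as soon as another particle arrives at its site. The $\mathrm{ARW}(K,\lambda,\nu)$ chain is the discrete-time Markov chain on $\mathcal X=\{0,\mathrm s\}^V$ which at each step adds an active particle at a $\nu$-distributed site and runs the ARW dynamics until no active particle remains. Let $P$ be its transition matrix and $\pi$ its invariant distribution, and set $$d_{\rm sep}(t)=\max_{\eta,\eta'\in\mathcal X}\Bigl(1-\frac{P^t(\eta,\eta')}{\pi(\eta')}\Bigr),\qquad t_{\rm sep}(\varepsilon)=\inf\{t\in\mathbb N: d_{\rm sep}(t)\le\varepsilon\},\qquad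 t_{\rm sep}=t_{\rm sep}(1/2),$$ $$\rho=\max\{|z| : z\in\mathbb C\setminus\{1\}\text{ is an eigenvalue of }P\},\qquad t_{\rm rel}=\frac1{1-\rho}.$$ **Theorem (Mixing window and cutoff).** These quantities are well defined: $P$ is a stochastic matrix with a unique invariant distribution $\pi$, which charges every state; $d_{\rm sep}(t)\to0$ as $t\to\infty$; and the maximum defining $\rho$ exists and is $<1$. Moreover: 1. For every $\varepsilon\in(0,1/2)$, $$t_{\rm sep}(\varepsilon)-t_{\rm sep}(1-\varepsilon)\le\sqrt{\frac{8\,t_{\rm rel}\,t_{\rm sep}}{\varepsilon}}.$$ 2. Consider a sequence of ARW chains, the $n$-th one on the set $V_n$ with statistics $d^{(n)}_{\rm sep}$, $t^{(n)}_{\rm sep}$, $t^{(n)}_{\rm rel}$. Say that it exhibits separation cutoff if for every fixed $\alpha\ge0$, as $n\to\infty$, $d^{(n)}_{\rm sep}(\lfloor\alpha t^{(n)}_{\rm sep}\rfloor)\to1$ if $\alpha<1$ and $\to0$ if $\alpha>1$; and that it satisfies the product condition if $t^{(n)}_{\rm rel}/t^{(n)}_{\rm sep}\to0$. The product condition always implies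 separation cutoff. If $t^{(n)}_{\rm sep}\to\infty$, then the sequence exhibits separation cutoff if and only if it satisfies the product condition. The same equivalence holds if $|V_n|\to\infty$. -/

import Mathlib

open Filter Topology

/-- State of one site: `s` is a single sleeping particle, `num k` means `k` active particles
(so `num 0` is an empty site). -/
inductive SiteState : Type
  | s : SiteState
  | num (k : ℕ) : SiteState

namespace SiteState

/-- Number of active particles on a site. -/
def active : SiteState → ℕ
  | s => 0
  | num k => k

/-- An active particle arrives; a sleeping particle already there becomes active. -/
def arrive : SiteState → SiteState
  | s => num 2
  | num k => num (k + 1)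

/-- An active particle leaves (only used when there is one). -/
def leave : SiteState → SiteState
  | s => s
  | num k => num (k - 1)

end SiteState

/-- Configurations of the particle system, i.e. elements of `{0, s, 1, 2, …}^V`. -/
abbrev ARWConfig (V : Type*) := V → SiteState

namespace ARWConfig

variable {V : Type*} [DecidableEq V]

/-- Add one active particle at `x`. -/
def add (ω : ARWConfig V) (x : V) : ARWConfig V := Function.update ω x (ω x).arrive

/-- Remove one active particle from `x`. -/
def kill (ω : ARWConfig V) (x : V) : ARWConfig V := Function.update ω x (ω x).leave

/-- One active particle jumps from `x` to `y` (possibly `y = x`). -/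
def jump (ω : ARWConfig V) (x y : V) : ARWConfig V := (ω.kill x).add y

/-- The particle alone at `x` falls asleep. -/
def sleep (ω : ARWConfig V) (x : V) : ARWConfig V := Function.update ω x SiteState.s

/-- A configuration is stable if it has no active particle. -/
def IsStable {V : Type*} (ω : ARWConfig V) : Prop := ∀ x, (ω x).active = 0

end ARWConfig

/-- The state space `{0, s}^V`: `true` stands for a sleeping particle, `false` for an empty site. -/
abbrev SleepConfig (V : Type*) := V → Bool

/-- A `{0, s}`-valued configuration seen as a configuration of the particle system. -/
def SleepConfig.toConfig {V : Type*} (η : SleepConfig V) : ARWConfig V :=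
  fun x => if η x then SiteState.s else SiteState.num 0

/-- The parameters `(K, λ, ν)` of an Activated Random Walk chain on the finite set `V`. -/
structure ARWData (V : Type*) [Fintype V] where
  /-- the sub-stochastic matrix -/
  K : V → V → ℝ
  K_nonneg : ∀ x y, 0 ≤ K x y
  K_row_le : ∀ x, ∑ y, K x y ≤ 1
  /-- no principal sub-matrix of `K` is stochastic -/
  K_nondegenerate : ∀ S : Finset V, S.Nonempty → ¬ ∀ x ∈ S, ∑ y ∈ S, K x y = 1
  /-- the sleeping rate `λ` -/
  rate : ℝ
  rate_pos : 0 < rate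
  /-- the law of the insertion site -/
  nu : V → ℝ
  nu_nonneg : ∀ x, 0 ≤ nu x
  nu_sum : ∑ x, nu x = 1
  /-- every site can be visited by the `K`-walk started from `ν` -/
  nu_reach : ∀ y, ∃ x, 0 < nu x ∧ Relation.ReflTransGen (fun a b => 0 < K a b) x y

namespace ARWData

noncomputable section

variable {V : Type*} [Fintype V] [DecidableEq V]

/-- The sum, over all transitions `ω → ω'` of the continuous-time dynamics, of the transition rate
times `f ω'`. Each active particle at `x` jumps to `y` at rate `K x y` and dies at rate
`1 - ∑ y, K x y`; an active particle alone at its site falls asleep at rate `λ`. -/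
def rateSum (A : ARWData V) (f : ARWConfig V → ℝ) (ω : ARWConfig V) : ℝ :=
  ∑ x, (((ω x).active : ℝ) *
      (∑ y, A.K x y * f (ω.jump x y) + (1 - ∑ y, A.K x y) * f (ω.kill x))
    + if (ω x).active = 1 then A.rate * f (ω.sleep x) else 0)

/-- The total rate at which the dynamics leaves `ω`. -/
def totalRate (A : ARWData V) (ω : ARWConfig V) : ℝ := A.rateSum (fun _ => 1) ω

open Classical in
/-- The transition operator `f ↦ (ω ↦ 𝔼_ω[f(Y₁)])` of the jump chain `Y` of the continuous-time
dynamics: a stable configuration is kept forever, and otherwise each transition is chosen with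
probability proportional to its rate. -/
def jumpOp (A : ARWData V) (f : ARWConfig V → ℝ) (ω : ARWConfig V) : ℝ :=
  if ω.IsStable then f ω else A.rateSum f ω / A.totalRate ω

open Classical in
/-- The probability that the dynamics started from `ω` is eventually absorbed in the stable
configuration `ξ`: the supremum (a nondecreasing limit) over `n` of `ℙ_ω(Y_n = ξ)`. -/
def stabProb (A : ARWData V) (ω : ARWConfig V) (ξ : SleepConfig V) : ℝ :=
  ⨆ n : ℕ, (A.jumpOp^[n] (fun ω' => if ω' = ξ.toConfig then 1 else 0)) ω

/-- The transition matrix of the `ARW(K, λ, ν)` chain: insert an active particle at a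
`ν`-distributed site, then stabilize. -/
def P (A : ARWData V) : Matrix (SleepConfig V) (SleepConfig V) ℝ :=
  Matrix.of fun η ξ => ∑ x, A.nu x * A.stabProb (η.toConfig.add x) ξ

/-- `π` is an invariant probability distribution of the chain. -/
def IsInvariant (A : ARWData V) (π : SleepConfig V → ℝ) : Prop :=
  (∀ η, 0 ≤ π η) ∧ ∑ η, π η = 1 ∧ Matrix.vecMul π A.P = π

/-- The invariant distribution of the chain. -/
def stat (A : ARWData V) : SleepConfig V → ℝ := Classical.epsilon A.IsInvariant

/-- The separation distance at time `t` (a maximum over a finite nonempty set). -/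
def dsep (A : ARWData V) (t : ℕ) : ℝ :=
  ⨆ q : SleepConfig V × SleepConfig V, (1 - (A.P ^ t) q.1 q.2 / A.stat q.2)

/-- The moduli of the complex eigenvalues of the transition matrix other than `1`. -/
def eigModuli (A : ARWData V) : Set ℝ :=
  {r | ∃ z : ℂ, z ≠ 1 ∧
    Module.End.HasEigenvalue (Matrix.toLin' (A.P.map (fun a : ℝ => (a : ℂ)))) z ∧ r = ‖z‖}

/-- The largest modulus of an eigenvalue other than `1`. -/
def rho (A : ARWData V) : ℝ := sSup A.eigModuli

/-- The relaxation time. -/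
def trel (A : ARWData V) : ℝ := 1 / (1 - A.rho)

/-- The separation mixing time with precision `ε`. -/
def tsep (A : ARWData V) (ε : ℝ) : ℕ := sInf {t : ℕ | A.dsep t ≤ ε}

end

end ARWData

section Sequences

variable {V : ℕ → Type*} [∀ n, Fintype (V n)] [∀ n, DecidableEq (V n)]

/-- Separation cutoff for a sequence of ARW chains. -/
def SeparationCutoff (A : ∀ n, ARWData (V n)) : Prop :=
  ∀ α : ℝ, 0 ≤ α →
    (α < 1 → Tendsto (fun n => (A n).dsep ⌊α * ((A n).tsep (1 / 2) : ℝ)⌋₊) atTop (𝓝 1)) ∧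
    (1 < α → Tendsto (fun n => (A n).dsep ⌊α * ((A n).tsep (1 / 2) : ℝ)⌋₊) atTop (𝓝 0))

/-- The product condition `t_rel = o(t_sep)` for a sequence of ARW chains. -/
def ProductCondition (A : ∀ n, ARWData (V n)) : Prop :=
  Tendsto (fun n => (A n).trel / ((A n).tsep (1 / 2) : ℝ)) atTop (𝓝 0)

end Sequences

/-!
# Mixing window and separation cutoff for Activated Random Walks

Everything rests on the abelian property, which is used in operator form. A bounded function `v` of
the configuration is called abelian-harmonic (`ARWData.IsHarmonic`) if toppling any active site
preserves it in mean. Topplings at distinct active sites commute (`ARWData.topple_comm`), whence a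
least action principle for the best probability of reaching a given stable configuration
(`ARWData.bestProb_le_topple`); it produces an abelian-harmonic function with prescribed values on
stable configurations. The dynamics being absorbed almost surely (`ARWData.tendsto_unstable`), this
function is the stabilization probability `ARWData.stabProb`, and abelian-harmonic functions are
determined by their values on stable configurations (`ARWData.IsHarmonic.eq_sum`). Hence the order
of topplings is irrelevant, and insertions may all be made before stabilizing
(`ARWData.P_pow_apply`).

Let a newly inserted particle move only as long as it shares its site with an active particle. The
set `S` of sites known to be occupied by an active particle then follows internal DLA: it grows
by the site `y` with probability `ARWData.growth S y`. Once `S = V`, additional particles are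
irrelevant and the stabilized configuration has the invariant law (`ARWData.stat_eq`). The filling
time `T` of internal DLA is thus a strong stationary time. It is optimal, because the state with
all sites asleep cannot be reached from the empty state before `T`, by conservation of particles;
so the separation distance at time `t` is exactly `ℙ(T > t)` (`ARWData.dsep_eq`).

For the window, `T` is shown to satisfy the variance bound `Var T ≤ trel * 𝔼 T`. In fact the mean
remaining time decreases by at most `max_y 1 / growth (V ∖ {y}) y` at each step
(`ARWData.truncTime_sub_add`, `ARWData.meanTime_sub_insert`), and `1 - growth (V ∖ {y}) y` is an
eigenvalue of the chain: the difference between the laws of the stabilizations of `V ∖ {y}` and `V`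
is a left eigenvector (`ARWData.hasEigenvalue_growth`). Since moreover `𝔼 T ≤ 2 tsep`
(`ARWData.meanTime_empty_le`), Chebyshev's inequality yields the window (`ARWData.tsep_sub_le`).

The product condition makes the window negligible compared with `tsep`, which is cutoff.
Conversely `rho ^ t ≤ dsep t` (`ARWData.rho_pow_le_dsep`), so that cutoff forces `trel` to be
negligible compared with `tsep` as soon as `tsep` diverges; and `tsep ≥ |V|`
(`ARWData.card_le_tsep`), since at least `|V|` particles are needed to fill `V`.
-/

/-! ### Instructions and toppling -/

namespace SiteState

/-- A sleep instruction: it acts on a lone active particle and is ignored otherwise. -/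
def doze : SiteState → SiteState
  | num 1 => s
  | t => t

/-- Number of particles on a site, asleep or not. -/
def count : SiteState → ℕ
  | s => 1
  | num k => k

theorem arrive_leave {t : SiteState} (h : 0 < t.active) : t.arrive.leave = t.leave.arrive := by
  rcases t with _ | _ | k <;> simp_all [active, arrive, leave]

theorem leave_arrive {t : SiteState} (h : 0 < t.active) : t.arrive.leave = t := by
  rcases t with _ | _ | k <;> simp_all [active, arrive, leave]

theorem arrive_doze {t : SiteState} (h : 0 < t.active) : t.arrive.doze = t.doze.arrive := by
  rcases t with _ | _ | _ | k <;> simp_all [active, arrive, doze]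

theorem doze_eq_self {t : SiteState} (h : t.active ≠ 1) : t.doze = t := by
  rcases t with _ | _ | _ | k <;> simp_all [active, doze]

theorem doze_eq_s {t : SiteState} (h : t.active = 1) : t.doze = s := by
  rcases t with _ | _ | _ | k <;> simp_all [active, doze]

theorem active_le_arrive (t : SiteState) : t.active + 1 ≤ t.arrive.active := by
  rcases t with _ | k <;> simp [active, arrive]

@[simp] theorem count_arrive (t : SiteState) : t.arrive.count = t.count + 1 := by
  rcases t with _ | k <;> simp [count, arrive]

theorem count_leave {t : SiteState} (h : 0 < t.active) : t.leave.count + 1 = t.count := by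
  rcases t with _ | _ | k <;> simp_all [active, leave, count]

@[simp] theorem count_doze (t : SiteState) : t.doze.count = t.count := by
  rcases t with _ | _ | _ | k <;> simp [doze, count]

end SiteState

namespace ARWConfig

variable {V : Type*} [DecidableEq V]

theorem add_apply (ω : ARWConfig V) (x z : V) :
    ω.add x z = if z = x then (ω x).arrive else ω z := by
  simp [add, Function.update_apply]

theorem active_le_add (ω : ARWConfig V) (x z : V) : (ω z).active ≤ (ω.add x z).active := by
  rw [add_apply]
  split_ifs with h
  · subst h
    exact (Nat.le_succ _).trans (ω z).active_le_arrive
  · rfl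

theorem add_comm (ω : ARWConfig V) (x y : V) : (ω.add x).add y = (ω.add y).add x := by
  rcases eq_or_ne x y with rfl | h
  · rfl
  · simp only [add, Function.update_of_ne h, Function.update_of_ne h.symm]
    exact Function.update_comm h _ _ _

/-- A site-wise operation commutes with the arrival of a particle as soon as it does so on the
states with an active particle. -/
theorem update_add (g : SiteState → SiteState)
    (hg : ∀ t : SiteState, 0 < t.active → g t.arrive = (g t).arrive)
    (ω : ARWConfig V) {x : V} (hx : 0 < (ω x).active) (y : V) :
    Function.update (ω.add y) x (g (ω.add y x)) =
      add (Function.update ω x (g (ω x))) y := by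
  rcases eq_or_ne x y with rfl | h
  · simp [add, hg _ hx]
  · simp only [add, Function.update_of_ne h, Function.update_of_ne h.symm]
    exact Function.update_comm h.symm _ _ _

/-- Execution at `x` of one instruction: `none` is a sleep instruction, `some none` a death,
`some (some y)` a jump to `y`. -/
def execute (ω : ARWConfig V) (x : V) : Option (Option V) → ARWConfig V
  | none => Function.update ω x (ω x).doze
  | some none => ω.kill x
  | some (some y) => ω.jump x y

theorem kill_add (ω : ARWConfig V) {x : V} (hx : 0 < (ω x).active) (y : V) :
    (ω.add y).kill x = (ω.kill x).add y :=
  update_add SiteState.leave (fun _ h => SiteState.arrive_leave h) ω hx y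

theorem execute_add (ω : ARWConfig V) {x : V} (hx : 0 < (ω x).active) (i : Option (Option V))
    (y : V) : (ω.add y).execute x i = (ω.execute x i).add y := by
  rcases i with _ | _ | z
  · exact update_add SiteState.doze (fun _ h => SiteState.arrive_doze h) ω hx y
  · exact kill_add ω hx y
  · simp only [execute, jump]
    rw [kill_add ω hx, add_comm]

theorem active_le_execute (ω : ARWConfig V) {x z : V} (hz : z ≠ x) (i : Option (Option V)) :
    (ω z).active ≤ (ω.execute x i z).active := by
  rcases i with _ | _ | y
  · simp [execute, Function.update_of_ne hz]
  · simp [execute, kill, Function.update_of_ne hz]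
  · refine le_trans ?_ (active_le_add _ _ _)
    simp [kill, Function.update_of_ne hz]

/-- Instructions at distinct sites carrying active particles commute. -/
theorem execute_comm (ω : ARWConfig V) {x y : V} (hxy : x ≠ y) (hx : 0 < (ω x).active)
    (hy : 0 < (ω y).active) (i j : Option (Option V)) :
    (ω.execute x i).execute y j = (ω.execute y j).execute x i := by
  -- jumps are split into a death and an arrival, and arrivals are moved outwards
  have key : ∀ g g' : SiteState → SiteState,
      Function.update (Function.update ω x (g (ω x))) y (g' ((Function.update ω x (g (ω x))) y)) =
      Function.update (Function.update ω y (g' (ω y))) x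
        (g ((Function.update ω y (g' (ω y))) x)) := by
    intro g g'
    rw [Function.update_of_ne hxy, Function.update_of_ne hxy.symm]
    exact Function.update_comm hxy.symm _ _ _ |>.symm
  have hxk : 0 < (ω.kill y x).active := by simpa [kill, Function.update_of_ne hxy] using hx
  have hyk : 0 < (ω.kill x y).active := by simpa [kill, Function.update_of_ne hxy.symm] using hy
  have hkk : (ω.kill x).kill y = (ω.kill y).kill x := key _ _
  have red : ∀ k l : Option (Option V), (k = none ∨ k = some none) →
      (l = none ∨ l = some none) →
      (ω.execute x k).execute y l = (ω.execute y l).execute x k := by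
    rintro k l (rfl | rfl) (rfl | rfl) <;> exact key _ _
  have half : ∀ k : Option (Option V), (k = none ∨ k = some none) → ∀ z,
      ((ω.execute x k).kill y).add z = ((ω.kill y).add z).execute x k := by
    intro k hk z
    rw [execute_add _ hxk]
    exact congrArg (fun ω' => add ω' z) (red k (some none) hk (Or.inr rfl))
  have half' : ∀ k : Option (Option V), (k = none ∨ k = some none) → ∀ z,
      ((ω.kill x).add z).execute y k = ((ω.execute y k).kill x).add z := by
    intro k hk z
    rw [execute_add _ hyk]
    exact congrArg (fun ω' => add ω' z) (red (some none) k (Or.inr rfl) hk)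
  rcases i with _ | _ | a <;> rcases j with _ | _ | b
  · exact red _ _ (Or.inl rfl) (Or.inl rfl)
  · exact red _ _ (Or.inl rfl) (Or.inr rfl)
  · exact half _ (Or.inl rfl) b
  · exact red _ _ (Or.inr rfl) (Or.inl rfl)
  · exact red _ _ (Or.inr rfl) (Or.inr rfl)
  · exact half _ (Or.inr rfl) b
  · exact half' _ (Or.inl rfl) a
  · exact half' _ (Or.inr rfl) a
  · change (((ω.kill x).add a).kill y).add b = (((ω.kill y).add b).kill x).add a
    rw [kill_add _ hyk, kill_add _ hxk, hkk, add_comm]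

theorem add_kill (ω : ARWConfig V) {x : V} (hx : 0 < (ω x).active) : (ω.add x).kill x = ω := by
  simp [add, kill, SiteState.leave_arrive hx]

end ARWConfig

namespace ARWData

variable {V : Type*} [Fintype V]

/-- The law of the next instruction at `x`. -/
noncomputable def weight (A : ARWData V) (x : V) : Option (Option V) → ℝ
  | none => A.rate / (1 + A.rate)
  | some none => (1 - ∑ y, A.K x y) / (1 + A.rate)
  | some (some y) => A.K x y / (1 + A.rate)

theorem weight_nonneg (A : ARWData V) (x : V) (i : Option (Option V)) : 0 ≤ A.weight x i := by
  have := A.rate_pos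
  rcases i with _ | _ | y
  · exact div_nonneg this.le (by linarith)
  · exact div_nonneg (by linarith [A.K_row_le x]) (by linarith)
  · exact div_nonneg (A.K_nonneg x y) (by linarith)

theorem weight_sum (A : ARWData V) (x : V) : ∑ i, A.weight x i = 1 := by
  have := A.rate_pos
  simp only [Fintype.sum_option, weight, ← Finset.sum_div]
  field_simp
  ring

variable [DecidableEq V]

/-- The toppling operator at `x`: the mean of `f` after a random instruction at `x`. -/
noncomputable def topple (A : ARWData V) (x : V) (f : ARWConfig V → ℝ) (ω : ARWConfig V) : ℝ :=
  ∑ i, A.weight x i * f (ω.execute x i)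

theorem topple_mono (A : ARWData V) (x : V) {f g : ARWConfig V → ℝ} {ω : ARWConfig V}
    (h : ∀ i, f (ω.execute x i) ≤ g (ω.execute x i)) : A.topple x f ω ≤ A.topple x g ω :=
  Finset.sum_le_sum fun i _ => mul_le_mul_of_nonneg_left (h i) (A.weight_nonneg x i)

theorem topple_const (A : ARWData V) (x : V) (c : ℝ) (ω : ARWConfig V) :
    A.topple x (fun _ => c) ω = c := by
  rw [topple, ← Finset.sum_mul, weight_sum, one_mul]

/-- The abelian property in infinitesimal form: topplings at distinct active sites commute. -/
theorem topple_comm (A : ARWData V) {x y : V} (hxy : x ≠ y) (f : ARWConfig V → ℝ)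
    {ω : ARWConfig V} (hx : 0 < (ω x).active) (hy : 0 < (ω y).active) :
    A.topple x (A.topple y f) ω = A.topple y (A.topple x f) ω := by
  simp only [topple, Finset.mul_sum]
  rw [Finset.sum_comm]
  refine Finset.sum_congr rfl fun i _ => Finset.sum_congr rfl fun j _ => ?_
  rw [ARWConfig.execute_comm ω hxy hx hy]
  ring

/-- The toppling operator, with the three kinds of instructions separated. -/
theorem topple_eq (A : ARWData V) (x : V) (f : ARWConfig V → ℝ) (ω : ARWConfig V) :
    (1 + A.rate) * A.topple x f ω =
      (∑ y, A.K x y * f (ω.jump x y) + (1 - ∑ y, A.K x y) * f (ω.kill x))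
        + A.rate * f (Function.update ω x (ω x).doze) := by
  have := A.rate_pos
  simp only [topple, Fintype.sum_option, weight, ARWConfig.execute, div_mul_eq_mul_div,
    ← Finset.sum_div]
  field_simp
  ring

/-- A bounded function is *abelian-harmonic* if toppling any active site preserves it in mean. The
abelian property says that the law of the stabilized configuration has this property. -/
structure IsHarmonic (A : ARWData V) (v : ARWConfig V → ℝ) : Prop where
  bounded : ∃ B, ∀ ω, |v ω| ≤ B
  topple_eq : ∀ ω x, 0 < (ω x).active → A.topple x v ω = v ω

theorem isHarmonic_const (A : ARWData V) (c : ℝ) : A.IsHarmonic fun _ => c :=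
  ⟨⟨|c|, fun _ => le_rfl⟩, fun ω x _ => A.topple_const x c ω⟩

theorem IsHarmonic.comp_add {A : ARWData V} {v : ARWConfig V → ℝ} (hv : A.IsHarmonic v) (a : V) :
    A.IsHarmonic fun ω => v (ω.add a) := by
  obtain ⟨B, hB⟩ := hv.bounded
  refine ⟨⟨B, fun ω => hB _⟩, fun ω x hx => ?_⟩
  rw [← hv.topple_eq _ x (hx.trans_le (ω.active_le_add a x))]
  simp only [topple, ARWConfig.execute_add ω hx]

theorem IsHarmonic.sum {A : ARWData V} {ι : Type*} (s : Finset ι) (c : ι → ℝ)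
    {v : ι → ARWConfig V → ℝ} (hv : ∀ i, A.IsHarmonic (v i)) :
    A.IsHarmonic fun ω => ∑ i ∈ s, c i * v i ω := by
  choose B hB using fun i => (hv i).bounded
  refine ⟨⟨∑ i ∈ s, |c i| * B i, fun ω => ?_⟩, fun ω x hx => ?_⟩
  · refine (Finset.abs_sum_le_sum_abs _ _).trans (Finset.sum_le_sum fun i _ => ?_)
    rw [abs_mul]
    exact mul_le_mul_of_nonneg_left (hB i ω) (abs_nonneg _)
  · simp only [topple, Finset.mul_sum]
    rw [Finset.sum_comm]
    refine Finset.sum_congr rfl fun i _ => ?_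
    rw [← (hv i).topple_eq ω x hx, topple, Finset.mul_sum]
    exact Finset.sum_congr rfl fun j _ => by ring

theorem IsHarmonic.sub {A : ARWData V} {v w : ARWConfig V → ℝ} (hv : A.IsHarmonic v)
    (hw : A.IsHarmonic w) : A.IsHarmonic fun ω => v ω - w ω := by
  have := IsHarmonic.sum (A := A) Finset.univ (fun b : Bool => if b then 1 else -1)
    (v := fun b => if b then v else w) (by rintro (_ | _) <;> simpa)
  simpa [Fintype.sum_bool, sub_eq_add_neg] using this

end ARWData

namespace SleepConfig

variable {V : Type*}

theorem toConfig_isStable (η : SleepConfig V) : η.toConfig.IsStable := fun x => by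
  rw [toConfig]
  split_ifs <;> rfl

theorem toConfig_injective : Function.Injective (toConfig (V := V)) := by
  intro η ξ h
  ext x
  have := congrFun h x
  simp only [toConfig] at this
  cases h1 : η x <;> cases h2 : ξ x <;> simp_all

end SleepConfig

theorem ARWConfig.IsStable.exists_toConfig_eq {V : Type*} {ω : ARWConfig V} (h : ω.IsStable) :
    ∃ η : SleepConfig V, η.toConfig = ω := by
  classical
  refine ⟨fun x => decide (ω x = SiteState.s), funext fun x => ?_⟩
  have := h x
  simp only [SleepConfig.toConfig, decide_eq_true_eq]
  generalize ω x = t at this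
  rcases t with _ | _ | k <;> simp_all [SiteState.active]

/-! ### The maximum principle for the killed walk -/

namespace ARWData

section Walk

variable {V : Type*} [Fintype V]

/-- Maximum principle for the walk killed at rate `1 - ∑ y, K x y`: this is the form in which the
absence of stochastic principal sub-matrices is used. -/
theorem nonpos_of_subharmonic (A : ARWData V) {b : V → ℝ}
    (hb : ∀ x, 0 < b x → b x ≤ ∑ y, A.K x y * b y) (x : V) : b x ≤ 0 := by
  by_contra! hx
  obtain ⟨m, -, hm⟩ := Finset.exists_max_image Finset.univ b ⟨x, Finset.mem_univ x⟩
  have hm' : ∀ y, b y ≤ b m := fun y => hm y (Finset.mem_univ y)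
  have hpos : 0 < b m := hx.trans_le (hm' x)
  -- the set where the maximum is attained carries a stochastic principal sub-matrix
  refine A.K_nondegenerate (Finset.univ.filter fun z => b z = b m) ⟨m, by simp⟩ fun z hz => ?_
  have hz : b z = b m := by simpa using hz
  have h1 : b m ≤ ∑ y, A.K z y * b y := hz ▸ hb z (hz ▸ hpos)
  have h2 : ∀ y, 0 ≤ A.K z y * (b m - b y) := fun y =>
    mul_nonneg (A.K_nonneg z y) (by linarith [hm' y])
  have h3 : ∑ y, A.K z y * (b m - b y) = (∑ y, A.K z y) * b m - ∑ y, A.K z y * b y := by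
    simp only [mul_sub, Finset.sum_sub_distrib, Finset.sum_mul]
  have h4 : (∑ y, A.K z y) * b m ≤ b m := by
    have := mul_le_mul_of_nonneg_right (A.K_row_le z) hpos.le
    linarith
  have h5 : ∑ y, A.K z y * (b m - b y) = 0 :=
    le_antisymm (by linarith) (Finset.sum_nonneg fun y _ => h2 y)
  have h6 : ∑ y, A.K z y = 1 := by
    have : (∑ y, A.K z y) * b m = 1 * b m := by linarith
    exact mul_right_cancel₀ hpos.ne' this
  rw [← h6]
  refine Finset.sum_subset (Finset.filter_subset _ _) fun y _ hy => ?_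
  have hy : b y ≠ b m := by simpa using hy
  have := (Finset.sum_eq_zero_iff_of_nonneg fun y _ => h2 y).1 h5 y (Finset.mem_univ y)
  rcases mul_eq_zero.1 this with h | h
  · exact h
  · exact absurd (by linarith) hy

theorem eq_zero_of_harmonic (A : ARWData V) {b : V → ℝ} (S : Finset V)
    (hS : ∀ x ∈ S, b x = ∑ y, A.K x y * b y) (hS' : ∀ x ∉ S, b x = 0) (x : V) : b x = 0 := by
  refine le_antisymm (A.nonpos_of_subharmonic (fun z hz => ?_) x) ?_
  · by_cases h : z ∈ S
    · exact (hS z h).le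
    · exact absurd (hS' z h) hz.ne'
  · have := A.nonpos_of_subharmonic (b := fun z => - b z) (fun z hz => ?_) x
    · linarith
    · by_cases h : z ∈ S
      · simp [hS z h]
      · simp [hS' z h] at hz

theorem active_nonempty_iff (ω : ARWConfig V) :
    (Finset.univ.filter fun x => 0 < (ω x).active).Nonempty ↔ ¬ ω.IsStable := by
  simp [Finset.Nonempty, ARWConfig.IsStable, Nat.pos_iff_ne_zero]

variable [DecidableEq V]

/-- Solvability of the Dirichlet problem for `1 - K` on `S`. -/
theorem exists_dirichlet (A : ARWData V) (S : Finset V) (c : V → ℝ) :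
    ∃ b : V → ℝ, (∀ x ∈ S, b x = c x + ∑ y, A.K x y * b y) ∧ ∀ x ∉ S, b x = c x := by
  let T : (V → ℝ) →ₗ[ℝ] (V → ℝ) :=
    { toFun := fun b x => if x ∈ S then b x - ∑ y, A.K x y * b y else b x
      map_add' := fun b b' => by
        ext x
        by_cases h : x ∈ S
        · simp [h, mul_add, Finset.sum_add_distrib]
          ring
        · simp [h]
      map_smul' := fun r b => by
        ext x
        by_cases h : x ∈ S
        · simp [h, mul_sub, Finset.mul_sum, mul_left_comm]
        · simp [h] }
  have hT : ∀ b x, T b x = if x ∈ S then b x - ∑ y, A.K x y * b y else b x := fun _ _ => rfl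
  have hinj : Function.Injective T := by
    rw [injective_iff_map_eq_zero]
    refine fun b hb => funext fun x => A.eq_zero_of_harmonic S (fun z hz => ?_) (fun z hz => ?_) x
    · have := congrFun hb z
      rw [hT, if_pos hz] at this
      exact sub_eq_zero.1 this
    · have := congrFun hb z
      rwa [hT, if_neg hz] at this
  obtain ⟨b, hb⟩ := LinearMap.injective_iff_surjective.1 hinj c
  refine ⟨b, fun x hx => ?_, fun x hx => ?_⟩
  · have := congrFun hb x
    rw [hT, if_pos hx] at this
    linarith
  · have := congrFun hb x
    rwa [hT, if_neg hx] at this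

/-- The mean number of steps of the killed walk is finite. -/
theorem exists_meanSteps (A : ARWData V) :
    ∃ G : V → ℝ, (∀ x, 0 ≤ G x) ∧ ∀ x, G x = 1 + ∑ y, A.K x y * G y := by
  obtain ⟨G, hG, -⟩ := A.exists_dirichlet Finset.univ fun _ => 1
  have hG : ∀ x, G x = 1 + ∑ y, A.K x y * G y := fun x => hG x (Finset.mem_univ x)
  refine ⟨G, fun x => ?_, hG⟩
  have := A.nonpos_of_subharmonic (b := fun z => - G z) (fun z _ => ?_) x
  · linarith
  · simp only [mul_neg, Finset.sum_neg_distrib]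
    linarith [hG z]

end Walk

/-! ### Absorption of the jump chain -/

variable {V : Type*} [Fintype V] [DecidableEq V]

theorem rateSum_mono (A : ARWData V) {f g : ARWConfig V → ℝ} (h : ∀ ω, f ω ≤ g ω)
    (ω : ARWConfig V) : A.rateSum f ω ≤ A.rateSum g ω := by
  refine Finset.sum_le_sum fun x _ => add_le_add ?_ ?_
  · refine mul_le_mul_of_nonneg_left (add_le_add ?_ ?_) (Nat.cast_nonneg _)
    · exact Finset.sum_le_sum fun y _ => mul_le_mul_of_nonneg_left (h _) (A.K_nonneg x y)
    · exact mul_le_mul_of_nonneg_left (h _) (by linarith [A.K_row_le x])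
  · split_ifs
    · exact mul_le_mul_of_nonneg_left (h _) A.rate_pos.le
    · rfl

theorem totalRate_eq (A : ARWData V) (ω : ARWConfig V) :
    A.totalRate ω = ∑ x, (((ω x).active : ℝ) + if (ω x).active = 1 then A.rate else 0) := by
  simp [totalRate, rateSum]

theorem totalRate_pos (A : ARWData V) {ω : ARWConfig V} (h : ¬ ω.IsStable) :
    0 < A.totalRate ω := by
  obtain ⟨x, hx⟩ := not_forall.1 h
  have hr := A.rate_pos
  have hn : ∀ z, 0 ≤ ((ω z).active : ℝ) + if (ω z).active = 1 then A.rate else 0 := fun z => by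
    split_ifs <;> positivity
  rw [totalRate_eq]
  refine Finset.sum_pos' (fun z _ => hn z) ⟨x, Finset.mem_univ x, ?_⟩
  have : 0 < ((ω x).active : ℝ) := by exact_mod_cast Nat.pos_of_ne_zero hx
  split_ifs <;> positivity

/-- The jump operator as a linear map. -/
noncomputable def jumpLin (A : ARWData V) : (ARWConfig V → ℝ) →ₗ[ℝ] (ARWConfig V → ℝ) where
  toFun := A.jumpOp
  map_add' f g := by
    ext ω
    by_cases h : ω.IsStable
    · simp [jumpOp, h]
    · simp only [jumpOp, h, if_false, Pi.add_apply, ← add_div, rateSum, ← Finset.sum_add_distrib]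
      congr 1
      refine Finset.sum_congr rfl fun x _ => ?_
      simp only [mul_add, Finset.sum_add_distrib]
      split_ifs <;> ring
  map_smul' r f := by
    ext ω
    by_cases h : ω.IsStable
    · simp [jumpOp, h]
    · simp only [jumpOp, h, if_false, Pi.smul_apply, smul_eq_mul, RingHom.id_apply, rateSum,
        ← mul_div_assoc]
      congr 1
      rw [Finset.mul_sum]
      refine Finset.sum_congr rfl fun x _ => ?_
      simp only [mul_left_comm _ r, ← Finset.mul_sum]
      split_ifs <;> ring

theorem iterate_jumpOp (A : ARWData V) (n : ℕ) : A.jumpOp^[n] = ⇑(A.jumpLin ^ n) := by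
  rw [Module.End.coe_pow]
  rfl

theorem jumpOp_of_isStable (A : ARWData V) (f : ARWConfig V → ℝ) {ω : ARWConfig V}
    (h : ω.IsStable) : A.jumpOp f ω = f ω := by
  simp [jumpOp, h]

theorem jumpOp_mono (A : ARWData V) : Monotone A.jumpOp := by
  intro f g h ω
  by_cases hω : ω.IsStable
  · simpa [jumpOp, hω] using h ω
  · simp only [jumpOp, hω, if_false]
    exact div_le_div_of_nonneg_right (A.rateSum_mono h ω) (A.totalRate_pos hω).le

theorem IsHarmonic.jumpOp_eq {A : ARWData V} {v : ARWConfig V → ℝ} (hv : A.IsHarmonic v) :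
    A.jumpOp v = v := by
  ext ω
  by_cases h : ω.IsStable
  · exact A.jumpOp_of_isStable v h
  simp only [jumpOp, h, if_false]
  rw [div_eq_iff (A.totalRate_pos h).ne', totalRate_eq, rateSum, Finset.mul_sum]
  refine Finset.sum_congr rfl fun x _ => ?_
  rcases Nat.eq_zero_or_pos (ω x).active with h0 | h0
  · simp [h0]
  have key := A.topple_eq x v ω
  rw [hv.topple_eq ω x h0] at key
  by_cases h1 : (ω x).active = 1
  · rw [SiteState.doze_eq_s h1] at key
    simp only [h1, if_true, ARWConfig.sleep]
    push_cast
    linarith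
  · rw [SiteState.doze_eq_self h1, Function.update_eq_self] at key
    simp only [h1, if_false]
    have : (∑ y, A.K x y * v (ω.jump x y) + (1 - ∑ y, A.K x y) * v (ω.kill x)) = v ω := by
      linarith
    rw [this]
    ring

open Classical in
/-- The indicator function of the unstable configurations. -/
noncomputable def unstableInd (ω : ARWConfig V) : ℝ := if ω.IsStable then 0 else 1

/-- A Lyapunov function: the total mean number of steps left to the particles, if they never fell
asleep, decreases by a definite amount at each transition. -/
theorem exists_lyapunov (A : ARWData V) : ∃ h : ARWConfig V → ℝ, (∀ ω, 0 ≤ h ω) ∧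
    ∀ ω, unstableInd ω + A.jumpOp h ω ≤ h ω := by
  obtain ⟨G, hG0, hG⟩ := A.exists_meanSteps
  have hr := A.rate_pos
  let h : ARWConfig V → ℝ := fun ω => (1 + A.rate) * ∑ z, ((ω z).count : ℝ) * G z
  have hup : ∀ (ω : ARWConfig V) x t,
      h (Function.update ω x t) = h ω + (1 + A.rate) * ((t.count : ℝ) - (ω x).count) * G x := by
    intro ω x t
    have : ∀ ω' : ARWConfig V, ∑ z, ((ω' z).count : ℝ) * G z =
        ((ω' x).count : ℝ) * G x + ∑ z ∈ Finset.univ.erase x, ((ω' z).count : ℝ) * G z :=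
      fun ω' => (Finset.add_sum_erase _ _ (Finset.mem_univ x)).symm
    have h2 : ∑ z ∈ Finset.univ.erase x, ((Function.update ω x t z).count : ℝ) * G z =
        ∑ z ∈ Finset.univ.erase x, ((ω z).count : ℝ) * G z :=
      Finset.sum_congr rfl fun z hz => by
        rw [Function.update_of_ne (Finset.ne_of_mem_erase hz)]
    simp only [h, this, h2, Function.update_self]
    ring
  refine ⟨h, fun ω => mul_nonneg (by linarith) (Finset.sum_nonneg fun z _ =>
    mul_nonneg (Nat.cast_nonneg _) (hG0 z)), fun ω => ?_⟩
  by_cases hs : ω.IsStable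
  · simp [unstableInd, jumpOp, hs]
  simp only [unstableInd, jumpOp, hs, if_false]
  have hT := A.totalRate_pos hs
  suffices A.totalRate ω + A.rateSum h ω ≤ h ω * A.totalRate ω by
    rw [← sub_nonneg] at this ⊢
    have e : h ω - (1 + A.rateSum h ω / A.totalRate ω) =
        (h ω * A.totalRate ω - (A.totalRate ω + A.rateSum h ω)) / A.totalRate ω := by
      field_simp
    rw [e]
    exact div_nonneg this hT.le
  rw [totalRate_eq, rateSum, ← Finset.sum_add_distrib, Finset.mul_sum]
  refine Finset.sum_le_sum fun x _ => ?_
  rcases Nat.eq_zero_or_pos (ω x).active with h0 | h0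
  · simp [h0]
  have hk : h (ω.kill x) = h ω - (1 + A.rate) * G x := by
    rw [ARWConfig.kill, hup, ← SiteState.count_leave h0]
    push_cast
    ring
  have hj : ∀ y, h (ω.jump x y) = h ω - (1 + A.rate) * G x + (1 + A.rate) * G y := fun y => by
    rw [ARWConfig.jump, ARWConfig.add, hup, hk, SiteState.count_arrive]
    push_cast
    ring
  have hmove : ∑ y, A.K x y * h (ω.jump x y) + (1 - ∑ y, A.K x y) * h (ω.kill x) =
      h ω - (1 + A.rate) := by
    simp only [hj, hk, mul_add, Finset.sum_add_distrib, ← Finset.sum_mul]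
    have : ∑ y, A.K x y * ((1 + A.rate) * G y) = (1 + A.rate) * (G x - 1) := by
      rw [hG x, add_sub_cancel_left, Finset.mul_sum]
      exact Finset.sum_congr rfl fun y _ => by ring
    rw [this]
    ring
  rw [hmove]
  by_cases h1 : (ω x).active = 1
  · have hsl : h (ω.sleep x) = h ω := by
      rw [ARWConfig.sleep, hup, ← SiteState.doze_eq_s h1, SiteState.count_doze]
      ring
    simp only [h1, if_true, hsl]
    push_cast
    linarith
  · simp only [h1, if_false]
    have : (0 : ℝ) ≤ (ω x).active := Nat.cast_nonneg _
    nlinarith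

/-- The dynamics is almost surely absorbed in a stable configuration. -/
theorem tendsto_unstable (A : ARWData V) (ω : ARWConfig V) :
    Tendsto (fun n => (A.jumpLin ^ n) unstableInd ω) atTop (𝓝 0) := by
  obtain ⟨h, h0, hh⟩ := A.exists_lyapunov
  have hpos : ∀ n, 0 ≤ (A.jumpLin ^ n) (unstableInd (V := V)) := by
    intro n
    induction n with
    | zero =>
      intro ω
      simp only [pow_zero, Module.End.one_apply, unstableInd, Pi.zero_apply]
      split_ifs <;> norm_num
    | succ n ih =>
      rw [pow_succ', Module.End.mul_apply]
      have := A.jumpOp_mono ih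
      rwa [show A.jumpOp 0 = 0 from A.jumpLin.map_zero] at this
  have hsum : ∀ n, ∑ k ∈ Finset.range n, (A.jumpLin ^ k) (unstableInd (V := V)) ≤ h := by
    intro n
    induction n with
    | zero => exact fun ω => by simpa using h0 ω
    | succ n ih =>
      rw [Finset.sum_range_succ']
      simp only [pow_succ', Module.End.mul_apply, pow_zero, Module.End.one_apply]
      rw [← map_sum]
      intro ω
      have := A.jumpOp_mono ih ω
      have h2 := hh ω
      change A.jumpOp _ ω + unstableInd ω ≤ h ω
      linarith
  refine (summable_of_sum_range_le (c := h ω) (fun n => hpos n ω) fun n => ?_).tendsto_atTop_zero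
  simpa using hsum n ω

theorem IsHarmonic.jumpLin_pow_eq {A : ARWData V} {v : ARWConfig V → ℝ} (hv : A.IsHarmonic v)
    (n : ℕ) : (A.jumpLin ^ n) v = v := by
  rw [← iterate_jumpOp, Function.iterate_fixed hv.jumpOp_eq]

theorem jumpLin_pow_mono (A : ARWData V) (n : ℕ) {f g : ARWConfig V → ℝ} (h : f ≤ g) :
    (A.jumpLin ^ n) f ≤ (A.jumpLin ^ n) g := by
  rw [← iterate_jumpOp]
  exact A.jumpOp_mono.iterate n h

theorem tendsto_jumpLin_of_bounded (A : ARWData V) {f : ARWConfig V → ℝ} {B : ℝ}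
    (hB : ∀ ω, |f ω| ≤ B) (hf : ∀ ω : ARWConfig V, ω.IsStable → f ω = 0) (ω : ARWConfig V) :
    Tendsto (fun n => (A.jumpLin ^ n) f ω) atTop (𝓝 0) := by
  have h1 : f ≤ B • unstableInd := fun ω => by
    by_cases hs : ω.IsStable
    · simp [unstableInd, hs, hf ω hs]
    · simpa [unstableInd, hs] using (abs_le.1 (hB ω)).2
  have h2 : (-B) • unstableInd ≤ f := fun ω => by
    by_cases hs : ω.IsStable
    · simp [unstableInd, hs, hf ω hs]
    · simpa [unstableInd, hs] using (abs_le.1 (hB ω)).1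
  have ht := A.tendsto_unstable ω
  refine tendsto_of_tendsto_of_tendsto_of_le_of_le (by simpa using ht.const_mul (-B))
    (by simpa using ht.const_mul B) (fun n => ?_) (fun n => ?_)
  · simpa using A.jumpLin_pow_mono n h2 ω
  · simpa using A.jumpLin_pow_mono n h1 ω

theorem IsHarmonic.eq_zero {A : ARWData V} {v : ARWConfig V → ℝ} (hv : A.IsHarmonic v)
    (h : ∀ ω : ARWConfig V, ω.IsStable → v ω = 0) (ω : ARWConfig V) : v ω = 0 := by
  obtain ⟨B, hB⟩ := hv.bounded
  have := A.tendsto_jumpLin_of_bounded hB h ω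
  simp only [hv.jumpLin_pow_eq] at this
  exact tendsto_nhds_unique tendsto_const_nhds this

/-! ### The abelian property -/

/-- The best probability, over all toppling strategies of at most `n` steps, to reach the stable
configuration `ζ`. -/
noncomputable def bestProb (A : ARWData V) (ζ : ARWConfig V) : ℕ → ARWConfig V → ℝ
  | 0, ω => open Classical in if ω = ζ then 1 else 0
  | n + 1, ω => open Classical in
      if h : (Finset.univ.filter fun x => 0 < (ω x).active).Nonempty then
        Finset.sup' _ h fun x => A.topple x (A.bestProb ζ n) ω
      else if ω = ζ then 1 else 0

open Classical in
theorem bestProb_of_isStable (A : ARWData V) (ζ : ARWConfig V) (n : ℕ) {ω : ARWConfig V}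
    (h : ω.IsStable) : A.bestProb ζ n ω = if ω = ζ then 1 else 0 := by
  rcases n with _ | n
  · rfl
  · rw [bestProb, dif_neg (by simpa [active_nonempty_iff] using h)]

theorem topple_le_bestProb (A : ARWData V) (ζ : ARWConfig V) (n : ℕ) {ω : ARWConfig V} {x : V}
    (hx : 0 < (ω x).active) : A.topple x (A.bestProb ζ n) ω ≤ A.bestProb ζ (n + 1) ω := by
  have hm : x ∈ Finset.univ.filter fun x => 0 < (ω x).active := by simpa using hx
  rw [bestProb, dif_pos ⟨x, hm⟩]
  exact Finset.le_sup' (fun x => A.topple x (A.bestProb ζ n) ω) hm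

theorem exists_bestProb_eq (A : ARWData V) (ζ : ARWConfig V) (n : ℕ) {ω : ARWConfig V} {x : V}
    (hx : 0 < (ω x).active) :
    ∃ y, 0 < (ω y).active ∧ A.bestProb ζ (n + 1) ω = A.topple y (A.bestProb ζ n) ω := by
  have hm : x ∈ Finset.univ.filter fun x => 0 < (ω x).active := by simpa using hx
  obtain ⟨y, hy, h⟩ := Finset.exists_mem_eq_sup' ⟨x, hm⟩ fun x => A.topple x (A.bestProb ζ n) ω
  exact ⟨y, by simpa using hy, by rw [bestProb, dif_pos ⟨x, hm⟩, h]⟩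

theorem bestProb_mem_Icc (A : ARWData V) (ζ : ARWConfig V) (n : ℕ) (ω : ARWConfig V) :
    0 ≤ A.bestProb ζ n ω ∧ A.bestProb ζ n ω ≤ 1 := by
  induction n generalizing ω with
  | zero =>
    rw [bestProb]
    split_ifs <;> norm_num
  | succ n ih =>
    by_cases hs : ω.IsStable
    · rw [bestProb_of_isStable A ζ _ hs]
      split_ifs <;> norm_num
    · obtain ⟨x, hx⟩ := (active_nonempty_iff ω).2 hs
      obtain ⟨y, -, hy⟩ := A.exists_bestProb_eq ζ n (by simpa using hx)
      rw [hy]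
      constructor
      · exact (A.topple_const y 0 ω).symm.le.trans (A.topple_mono y fun i => (ih _).1)
      · exact (A.topple_mono y fun i => (ih _).2).trans (A.topple_const y 1 ω).le

theorem bestProb_zero_of_unstable (A : ARWData V) {ζ : ARWConfig V} (hζ : ζ.IsStable)
    {ω : ARWConfig V} (h : ¬ ω.IsStable) : A.bestProb ζ 0 ω = 0 := by
  rw [bestProb, if_neg]
  rintro rfl
  exact h hζ

theorem bestProb_le_succ (A : ARWData V) {ζ : ARWConfig V} (hζ : ζ.IsStable) (n : ℕ)
    (ω : ARWConfig V) : A.bestProb ζ n ω ≤ A.bestProb ζ (n + 1) ω := by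
  induction n generalizing ω with
  | zero =>
    by_cases hs : ω.IsStable
    · rw [bestProb_of_isStable A ζ _ hs, bestProb_of_isStable A ζ _ hs]
    · rw [bestProb_zero_of_unstable A hζ hs]
      exact (A.bestProb_mem_Icc ζ _ ω).1
  | succ n ih =>
    by_cases hs : ω.IsStable
    · rw [bestProb_of_isStable A ζ _ hs, bestProb_of_isStable A ζ _ hs]
    · obtain ⟨x, hx⟩ := (active_nonempty_iff ω).2 hs
      obtain ⟨y, hy0, hy⟩ := A.exists_bestProb_eq ζ n (by simpa using hx)
      rw [hy]
      exact (A.topple_mono y fun i => ih _).trans (A.topple_le_bestProb ζ _ hy0)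

/-- The least action principle: an active site has to be toppled sooner or later, and toppling it
first costs nothing. -/
theorem bestProb_le_topple (A : ARWData V) {ζ : ARWConfig V} (hζ : ζ.IsStable) (n : ℕ)
    {ω : ARWConfig V} {x : V} (hx : 0 < (ω x).active) :
    A.bestProb ζ n ω ≤ A.topple x (A.bestProb ζ n) ω := by
  induction n generalizing ω with
  | zero =>
    rw [bestProb_zero_of_unstable A hζ fun h => hx.ne' (h x)]
    exact (A.topple_const x 0 ω).symm.le.trans
      (A.topple_mono x fun i => (A.bestProb_mem_Icc ζ 0 _).1)
  | succ n ih =>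
    obtain ⟨y, hy0, hy⟩ := A.exists_bestProb_eq ζ n hx
    rw [hy]
    rcases eq_or_ne y x with rfl | hyx
    · exact A.topple_mono y fun i => A.bestProb_le_succ hζ n _
    · calc A.topple y (A.bestProb ζ n) ω
          ≤ A.topple y (A.topple x (A.bestProb ζ n)) ω := A.topple_mono y fun i =>
            ih (hx.trans_le (ω.active_le_execute hyx.symm i))
        _ = A.topple x (A.topple y (A.bestProb ζ n)) ω := A.topple_comm hyx _ hy0 hx
        _ ≤ A.topple x (A.bestProb ζ (n + 1)) ω := A.topple_mono x fun i =>
            A.topple_le_bestProb ζ n (hy0.trans_le (ω.active_le_execute hyx i))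

open Classical in
theorem exists_isHarmonic (A : ARWData V) {ζ : ARWConfig V} (hζ : ζ.IsStable) :
    ∃ u : ARWConfig V → ℝ, A.IsHarmonic u ∧ (∀ ω, 0 ≤ u ω) ∧
      ∀ ω : ARWConfig V, ω.IsStable → u ω = if ω = ζ then 1 else 0 := by
  have hmono : ∀ ω, Monotone fun n => A.bestProb ζ n ω := fun ω =>
    monotone_nat_of_le_succ fun n => A.bestProb_le_succ hζ n ω
  have hbdd : ∀ ω, BddAbove (Set.range fun n => A.bestProb ζ n ω) := fun ω =>
    ⟨1, by rintro _ ⟨n, rfl⟩; exact (A.bestProb_mem_Icc ζ n ω).2⟩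
  have hlim : ∀ ω, Tendsto (fun n => A.bestProb ζ n ω) atTop (𝓝 (⨆ n, A.bestProb ζ n ω)) :=
    fun ω => tendsto_atTop_ciSup (hmono ω) (hbdd ω)
  have h0 : ∀ ω, 0 ≤ ⨆ n, A.bestProb ζ n ω := fun ω =>
    ge_of_tendsto' (hlim ω) fun n => (A.bestProb_mem_Icc ζ n ω).1
  refine ⟨fun ω => ⨆ n, A.bestProb ζ n ω, ⟨⟨1, fun ω => ?_⟩, fun ω x hx => ?_⟩, h0,
    fun ω hω => ?_⟩
  · rw [abs_of_nonneg (h0 ω)]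
    exact le_of_tendsto' (hlim ω) fun n => (A.bestProb_mem_Icc ζ n ω).2
  · have ht : Tendsto (fun n => A.topple x (A.bestProb ζ n) ω) atTop
        (𝓝 (A.topple x (fun ω => ⨆ n, A.bestProb ζ n ω) ω)) :=
      tendsto_finsetSum _ fun i _ => (hlim _).const_mul _
    exact le_antisymm
      (le_of_tendsto_of_tendsto' ht ((tendsto_add_atTop_iff_nat 1).2 (hlim ω)) fun n =>
        A.topple_le_bestProb ζ n hx)
      (le_of_tendsto_of_tendsto' (hlim ω) ht fun n => A.bestProb_le_topple hζ n hx)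
  · simp [A.bestProb_of_isStable ζ _ hω]

theorem stabProb_eq_of_isHarmonic (A : ARWData V) (ξ : SleepConfig V) {u : ARWConfig V → ℝ}
    (hu : A.IsHarmonic u) (h0 : ∀ ω, 0 ≤ u ω)
    (hs : ∀ ω : ARWConfig V, ω.IsStable → u ω = open Classical in if ω = ξ.toConfig then 1 else 0) :
    (fun ω => A.stabProb ω ξ) = u := by
  classical
  ext ω
  have hle : ∀ n ω, (A.jumpOp^[n] (fun ω' => if ω' = ξ.toConfig then 1 else 0)) ω ≤ u ω := by
    intro n
    rw [iterate_jumpOp]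
    refine fun ω => (A.jumpLin_pow_mono n (fun ω => ?_) ω).trans_eq
      (congrFun (hu.jumpLin_pow_eq n) ω)
    simp only
    split_ifs with h
    · subst h
      simp [hs _ ξ.toConfig_isStable]
    · exact h0 ω
  have hlim : Tendsto (fun n => (A.jumpOp^[n] (fun ω' => if ω' = ξ.toConfig then 1 else 0)) ω)
      atTop (𝓝 (u ω)) := by
    obtain ⟨B, hB⟩ := hu.bounded
    have := A.tendsto_jumpLin_of_bounded
      (f := u - fun ω' => if ω' = ξ.toConfig then 1 else 0) (B := B + 1) (fun ω => ?_)
      (fun ω hω => ?_) ω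
    · simp only [map_sub, hu.jumpLin_pow_eq, Pi.sub_apply] at this
      simpa [iterate_jumpOp] using this.const_sub (u ω)
    · refine (abs_sub _ _).trans (add_le_add (hB ω) ?_)
      simp only
      split_ifs <;> simp
    · simp [hs ω hω]
  refine le_antisymm ?_ ?_
  · rw [stabProb]
    convert ciSup_le fun n => hle n ω
  · refine le_of_tendsto' hlim fun n => ?_
    rw [stabProb]
    convert le_ciSup (f := fun n => (A.jumpOp^[n] (fun ω' => if ω' = ξ.toConfig then 1 else 0)) ω)
      ⟨u ω, by rintro _ ⟨n, rfl⟩; exact hle n ω⟩ n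

theorem isHarmonic_stabProb (A : ARWData V) (ξ : SleepConfig V) :
    A.IsHarmonic fun ω => A.stabProb ω ξ := by
  obtain ⟨u, hu, h0, hs⟩ := A.exists_isHarmonic ξ.toConfig_isStable
  rwa [A.stabProb_eq_of_isHarmonic ξ hu h0 hs]

theorem stabProb_nonneg (A : ARWData V) (ω : ARWConfig V) (ξ : SleepConfig V) :
    0 ≤ A.stabProb ω ξ := by
  obtain ⟨u, hu, h0, hs⟩ := A.exists_isHarmonic ξ.toConfig_isStable
  rw [congrFun (A.stabProb_eq_of_isHarmonic ξ hu h0 hs) ω]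
  exact h0 ω

theorem stabProb_toConfig (A : ARWData V) (η ξ : SleepConfig V) :
    A.stabProb η.toConfig ξ = if η = ξ then 1 else 0 := by
  obtain ⟨u, hu, h0, hs⟩ := A.exists_isHarmonic ξ.toConfig_isStable
  rw [congrFun (A.stabProb_eq_of_isHarmonic ξ hu h0 hs) _, hs _ η.toConfig_isStable]
  simp [SleepConfig.toConfig_injective.eq_iff]

/-- Abelian-harmonic functions are determined by their values on stable configurations. -/
theorem IsHarmonic.eq_sum {A : ARWData V} {v : ARWConfig V → ℝ} (hv : A.IsHarmonic v)
    (ω : ARWConfig V) : v ω = ∑ ξ : SleepConfig V, v ξ.toConfig * A.stabProb ω ξ := by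
  have h := hv.sub (IsHarmonic.sum Finset.univ (fun ξ : SleepConfig V => v ξ.toConfig)
    fun ξ => A.isHarmonic_stabProb ξ)
  refine sub_eq_zero.1 (h.eq_zero (fun ω' hω => ?_) ω)
  obtain ⟨η, rfl⟩ := hω.exists_toConfig_eq
  simp [stabProb_toConfig]

end ARWData

/-! ### Walking a particle through active sites -/

namespace ARWConfig

variable {V : Type*} [DecidableEq V]

/-- One active particle on each site of `S`, and no other particle. -/
def ofFinset (S : Finset V) : ARWConfig V :=
  fun x => if x ∈ S then SiteState.num 1 else SiteState.num 0

theorem ofFinset_add {S : Finset V} {y : V} (hy : y ∉ S) :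
    (ofFinset S).add y = ofFinset (insert y S) := by
  ext z
  rw [add_apply]
  by_cases h : z = y
  · subst h
    simp [ofFinset, hy, SiteState.arrive]
  · simp [ofFinset, h]

/-- All sites of `S` carry an active particle. -/
def ActiveOn {V : Type*} (S : Finset V) (ω : ARWConfig V) : Prop := ∀ x ∈ S, 0 < (ω x).active

theorem activeOn_ofFinset (S : Finset V) : (ofFinset S).ActiveOn S := fun x hx => by
  simp [ofFinset, hx, SiteState.active]

theorem ActiveOn.add {S : Finset V} {ω : ARWConfig V} (h : ω.ActiveOn S) (y : V) :
    (ω.add y).ActiveOn S := fun x hx => (h x hx).trans_le (ω.active_le_add y x)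

theorem ActiveOn.insert {S : Finset V} {ω : ARWConfig V} (h : ω.ActiveOn S) (y : V) :
    (ω.add y).ActiveOn (insert y S) := fun x hx => by
  rcases Finset.mem_insert.1 hx with rfl | hx
  · rw [add_apply, if_pos rfl]
    exact Nat.succ_pos _ |>.trans_le (ω x).active_le_arrive
  · exact h.add y x hx

theorem kill_add_self (ω : ARWConfig V) {x : V} (hx : 0 < (ω x).active) :
    (ω.kill x).add x = ω := by
  rw [← kill_add ω hx, add_kill ω hx]

variable [Fintype V]

/-- The total number of particles. -/
def numParticles {V : Type*} [Fintype V] (ω : ARWConfig V) : ℕ := ∑ x, (ω x).count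

theorem numParticles_update (ω : ARWConfig V) (x : V) (t : SiteState) :
    numParticles (Function.update ω x t) + (ω x).count = ω.numParticles + t.count := by
  have : ∀ ω' : ARWConfig V, ω'.numParticles =
      (ω' x).count + ∑ z ∈ Finset.univ.erase x, (ω' z).count :=
    fun ω' => (Finset.add_sum_erase _ _ (Finset.mem_univ x)).symm
  have h2 : ∑ z ∈ Finset.univ.erase x, (Function.update ω x t z).count =
      ∑ z ∈ Finset.univ.erase x, (ω z).count :=
    Finset.sum_congr rfl fun z hz => by
      rw [Function.update_of_ne (Finset.ne_of_mem_erase hz)]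
  rw [this, this ω, h2, Function.update_self]
  ring

theorem numParticles_add (ω : ARWConfig V) (x : V) :
    (ω.add x).numParticles = ω.numParticles + 1 := by
  have := numParticles_update ω x (ω x).arrive
  rw [SiteState.count_arrive] at this
  rw [add]
  omega

theorem numParticles_kill (ω : ARWConfig V) {x : V} (hx : 0 < (ω x).active) :
    (ω.kill x).numParticles + 1 = ω.numParticles := by
  have := numParticles_update ω x (ω x).leave
  have h2 := SiteState.count_leave hx
  rw [kill]
  omega

theorem numParticles_jump (ω : ARWConfig V) {x : V} (hx : 0 < (ω x).active) (y : V) :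
    (ω.jump x y).numParticles = ω.numParticles := by
  rw [jump, numParticles_add, numParticles_kill ω hx]

theorem numParticles_sleep (ω : ARWConfig V) {x : V} (hx : (ω x).active = 1) :
    (ω.sleep x).numParticles = ω.numParticles := by
  have := numParticles_update ω x (ω x).doze
  rw [SiteState.count_doze, SiteState.doze_eq_s hx] at this
  rw [sleep]
  omega

end ARWConfig

namespace ARWData

variable {V : Type*} [Fintype V] [DecidableEq V]

/-- The particle which has just arrived at `x ∈ S` walks one step while all the other ones are
frozen. -/
theorem IsHarmonic.add_eq {A : ARWData V} {v : ARWConfig V → ℝ} (hv : A.IsHarmonic v)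
    {ω : ARWConfig V} {x : V} (hx : 0 < (ω x).active) :
    v (ω.add x) = ∑ y, A.K x y * v (ω.add y) + (1 - ∑ y, A.K x y) * v ω := by
  have h2 : 2 ≤ (ω.add x x).active := by
    rw [ARWConfig.add_apply, if_pos rfl]
    have := (ω x).active_le_arrive
    omega
  have key := A.topple_eq x v (ω.add x)
  rw [hv.topple_eq _ x (by omega), SiteState.doze_eq_self (by omega),
    Function.update_eq_self] at key
  simp only [ARWConfig.jump, ARWConfig.add_kill ω hx] at key
  linarith

/-- The probability that the walk from `x` leaves `S` alive, and does so at `y`. -/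
noncomputable def exitProb (A : ARWData V) (S : Finset V) (y : V) : V → ℝ :=
  (A.exists_dirichlet S fun x => if x ∈ S then 0 else if x = y then 1 else 0).choose

theorem exitProb_of_mem (A : ARWData V) {S : Finset V} (y : V) {x : V} (hx : x ∈ S) :
    A.exitProb S y x = ∑ z, A.K x z * A.exitProb S y z := by
  have := (A.exists_dirichlet S fun x => if x ∈ S then 0 else if x = y then 1 else 0).choose_spec.1
    x hx
  rwa [if_pos hx, zero_add] at this

theorem exitProb_of_notMem (A : ARWData V) {S : Finset V} (y : V) {x : V} (hx : x ∉ S) :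
    A.exitProb S y x = if x = y then 1 else 0 := by
  have := (A.exists_dirichlet S fun x => if x ∈ S then 0 else if x = y then 1 else 0).choose_spec.2
    x hx
  rwa [if_neg hx] at this

theorem exitProb_nonneg (A : ARWData V) (S : Finset V) (y x : V) : 0 ≤ A.exitProb S y x := by
  have := A.nonpos_of_subharmonic (b := fun z => - A.exitProb S y z) (fun z hz => ?_) x
  · linarith
  · by_cases h : z ∈ S
    · simp [A.exitProb_of_mem y h]
    · simp only [A.exitProb_of_notMem y h] at hz
      split_ifs at hz <;> linarith

theorem sum_exitProb_of_notMem (A : ARWData V) {S : Finset V} {x : V} (hx : x ∉ S) (f : V → ℝ) :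
    ∑ y ∈ Sᶜ, A.exitProb S y x * f y = f x := by
  simp [A.exitProb_of_notMem _ hx, hx]

theorem sum_exitProb_of_mem (A : ARWData V) {S : Finset V} {x : V} (hx : x ∈ S) (f : V → ℝ) :
    ∑ y ∈ Sᶜ, A.exitProb S y x * f y = ∑ z, A.K x z * ∑ y ∈ Sᶜ, A.exitProb S y z * f y := by
  simp only [Finset.mul_sum]
  rw [Finset.sum_comm]
  refine Finset.sum_congr rfl fun y _ => ?_
  rw [A.exitProb_of_mem y hx, Finset.sum_mul]
  exact Finset.sum_congr rfl fun z _ => by ring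

theorem sum_exitProb_le_one (A : ARWData V) (S : Finset V) (x : V) :
    ∑ y ∈ Sᶜ, A.exitProb S y x ≤ 1 := by
  have := A.nonpos_of_subharmonic (b := fun z => ∑ y ∈ Sᶜ, A.exitProb S y z - 1)
    (fun z hz => ?_) x
  · linarith
  · by_cases h : z ∈ S
    · have := A.sum_exitProb_of_mem h fun _ => 1
      simp only [mul_one] at this
      simp only [mul_sub, mul_one, Finset.sum_sub_distrib, ← this]
      linarith [A.K_row_le z]
    · have := A.sum_exitProb_of_notMem h fun _ => 1
      simp only [mul_one] at this
      linarith

/-- The particle which has just arrived at `x` walks until it dies or leaves the set `S` of active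
sites, all the other particles being frozen. -/
theorem IsHarmonic.add_eq_exit {A : ARWData V} {v : ARWConfig V → ℝ} (hv : A.IsHarmonic v)
    {ω : ARWConfig V} {S : Finset V} (hω : ω.ActiveOn S) (x : V) :
    v (ω.add x) = v ω + ∑ y ∈ Sᶜ, A.exitProb S y x * (v (ω.add y) - v ω) := by
  have := A.eq_zero_of_harmonic (b := fun x => v (ω.add x) - v ω -
    ∑ y ∈ Sᶜ, A.exitProb S y x * (v (ω.add y) - v ω)) S (fun z hz => ?_) (fun z hz => ?_) x
  · linarith
  · simp only [mul_sub (A.K _ _), Finset.sum_sub_distrib, ← Finset.sum_mul]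
    rw [← A.sum_exitProb_of_mem hz fun y => v (ω.add y) - v ω, hv.add_eq (hω z hz)]
    ring
  · simp only [A.sum_exitProb_of_notMem hz fun y => v (ω.add y) - v ω, sub_self]

/-- The mean of `v` after insertion of an active particle at a `ν`-distributed site. -/
noncomputable def ins (A : ARWData V) (v : ARWConfig V → ℝ) (ω : ARWConfig V) : ℝ :=
  ∑ x, A.nu x * v (ω.add x)

theorem IsHarmonic.ins {A : ARWData V} {v : ARWConfig V → ℝ} (hv : A.IsHarmonic v) :
    A.IsHarmonic (A.ins v) :=
  IsHarmonic.sum Finset.univ A.nu fun x => hv.comp_add x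

theorem IsHarmonic.ins_iterate {A : ARWData V} {v : ARWConfig V → ℝ} (hv : A.IsHarmonic v)
    (t : ℕ) : A.IsHarmonic (A.ins^[t] v) := by
  induction t with
  | zero => exact hv
  | succ t ih =>
    rw [Function.iterate_succ_apply']
    exact ih.ins

/-- The transition probabilities of internal DLA: the probability that the cluster `S` grows by the
site `y` when a walker starting from `ν` is sent. -/
noncomputable def growth (A : ARWData V) (S : Finset V) (y : V) : ℝ :=
  ∑ x, A.nu x * A.exitProb S y x

theorem growth_nonneg (A : ARWData V) (S : Finset V) (y : V) : 0 ≤ A.growth S y :=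
  Finset.sum_nonneg fun x _ => mul_nonneg (A.nu_nonneg x) (A.exitProb_nonneg S y x)

theorem sum_growth (A : ARWData V) (S : Finset V) (f : V → ℝ) :
    ∑ y ∈ Sᶜ, A.growth S y * f y = ∑ x, A.nu x * ∑ y ∈ Sᶜ, A.exitProb S y x * f y := by
  simp only [growth, Finset.sum_mul, Finset.mul_sum]
  rw [Finset.sum_comm]
  exact Finset.sum_congr rfl fun x _ => Finset.sum_congr rfl fun y _ => by ring

theorem sum_growth_le_one (A : ARWData V) (S : Finset V) : ∑ y ∈ Sᶜ, A.growth S y ≤ 1 := by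
  have := A.sum_growth S fun _ => 1
  simp only [mul_one] at this
  rw [this, ← A.nu_sum]
  exact Finset.sum_le_sum fun x _ =>
    mul_le_of_le_one_right (A.nu_nonneg x) (A.sum_exitProb_le_one S x)

/-- Every cluster other than `V` grows with positive probability, since every site can be reached
from the support of `ν`. -/
theorem sum_growth_pos (A : ARWData V) {S : Finset V} (hS : S ≠ Finset.univ) :
    0 < ∑ y ∈ Sᶜ, A.growth S y := by
  obtain ⟨y, hy⟩ : ∃ y, y ∉ S := by
    by_contra! h
    exact hS (Finset.eq_univ_of_forall h)
  obtain ⟨x, hx, hxy⟩ := A.nu_reach y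
  have hpos : 0 < ∑ z ∈ Sᶜ, A.exitProb S z x := by
    have e0 := fun z (hz : z ∉ S) => A.sum_exitProb_of_notMem hz fun _ => 1
    have e1 := fun z (hz : z ∈ S) => A.sum_exitProb_of_mem hz fun _ => 1
    simp only [mul_one] at e0 e1
    clear hx
    induction hxy using Relation.ReflTransGen.head_induction_on with
    | refl => rw [e0 y hy]; exact one_pos
    | @head a b hab _ ih =>
      by_cases ha : a ∈ S
      · rw [e1 a ha]
        exact Finset.sum_pos' (fun z _ => mul_nonneg (A.K_nonneg a z)
          (Finset.sum_nonneg fun w _ => A.exitProb_nonneg S w z))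
          ⟨b, Finset.mem_univ b, mul_pos hab ih⟩
      · rw [e0 a ha]
        exact one_pos
  have := A.sum_growth S fun _ => 1
  simp only [mul_one] at this
  rw [this]
  exact Finset.sum_pos' (fun z _ => mul_nonneg (A.nu_nonneg z)
    (Finset.sum_nonneg fun w _ => A.exitProb_nonneg S w z))
    ⟨x, Finset.mem_univ x, mul_pos hx hpos⟩

theorem IsHarmonic.ins_eq {A : ARWData V} {v : ARWConfig V → ℝ} (hv : A.IsHarmonic v)
    {ω : ARWConfig V} {S : Finset V} (hω : ω.ActiveOn S) :
    A.ins v ω = v ω + ∑ y ∈ Sᶜ, A.growth S y * (v (ω.add y) - v ω) := by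
  rw [ARWData.ins, A.sum_growth S fun y => v (ω.add y) - v ω]
  rw [Finset.sum_congr rfl fun x _ => congrArg (A.nu x * ·) (hv.add_eq_exit hω x)]
  simp only [mul_add, Finset.sum_add_distrib, ← Finset.sum_mul, A.nu_sum, one_mul]

theorem IsHarmonic.ins_ofFinset {A : ARWData V} {v : ARWConfig V → ℝ} (hv : A.IsHarmonic v)
    (S : Finset V) :
    A.ins v (.ofFinset S) = v (.ofFinset S) +
      ∑ y ∈ Sᶜ, A.growth S y * (v (.ofFinset (insert y S)) - v (.ofFinset S)) := by
  rw [hv.ins_eq (ARWConfig.activeOn_ofFinset S)]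
  congr 1
  refine Finset.sum_congr rfl fun y hy => ?_
  rw [ARWConfig.ofFinset_add (Finset.mem_compl.1 hy)]

/-- When all sites are active, additional particles may walk until they die: they are irrelevant. -/
theorem IsHarmonic.eq_ofFinset_univ {A : ARWData V} {v : ARWConfig V → ℝ} (hv : A.IsHarmonic v)
    {ω : ARWConfig V} (hω : ω.ActiveOn Finset.univ) : v ω = v (.ofFinset Finset.univ) := by
  induction h : ω.numParticles using Nat.strong_induction_on generalizing ω with
  | _ n ih =>
    by_cases h1 : ∀ x, (ω x).active = 1
    · congr 1
      ext x
      have := h1 x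
      simp only [ARWConfig.ofFinset, Finset.mem_univ, if_true]
      generalize ω x = t at this
      rcases t with _ | k <;> simp_all [SiteState.active]
    · obtain ⟨x, hx⟩ := not_forall.1 h1
      have hx0 := hω x (Finset.mem_univ x)
      have hk : (ω.kill x).ActiveOn Finset.univ := by
        intro z _
        by_cases hz : z = x
        · subst hz
          rw [ARWConfig.kill, Function.update_self]
          generalize ω z = t at hx0 hx
          rcases t with _ | _ | _ | k <;> simp_all [SiteState.active, SiteState.leave]
        · rw [ARWConfig.kill, Function.update_of_ne hz]
          exact hω z (Finset.mem_univ z)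
      have hn := ω.numParticles_kill hx0
      rw [← ih _ (by omega) hk rfl]
      conv_lhs => rw [← ω.kill_add_self hx0, hv.add_eq_exit hk x]
      simp

/-! ### The stationary distribution -/

/-- Conservation of the number of particles. -/
theorem stabProb_eq_zero_of_lt (A : ARWData V) {ω : ARWConfig V} {ξ : SleepConfig V}
    (h : ω.numParticles < ξ.toConfig.numParticles) : A.stabProb ω ξ = 0 := by
  classical
  have key : ∀ n, ∀ ω : ARWConfig V, ω.numParticles < ξ.toConfig.numParticles →
      (A.jumpOp^[n] (fun ω' => if ω' = ξ.toConfig then 1 else 0)) ω = 0 := by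
    intro n
    induction n with
    | zero =>
      intro ω h
      simp only [Function.iterate_zero, id]
      rw [if_neg]
      rintro rfl
      exact h.false
    | succ n ih =>
      intro ω h
      rw [Function.iterate_succ_apply']
      by_cases hs : ω.IsStable
      · rw [A.jumpOp_of_isStable _ hs, ih ω h]
      · simp only [jumpOp, hs, if_false]
        rw [div_eq_zero_iff]
        left
        refine Finset.sum_eq_zero fun x _ => ?_
        rcases Nat.eq_zero_or_pos (ω x).active with h0 | h0
        · simp [h0]
        · have h1 := ω.numParticles_kill h0
          rw [ih _ (by omega)]
          simp only [ih _ ((ω.numParticles_jump h0 _).trans_lt h)]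
          split_ifs with h2
          · rw [ih _ ((ω.numParticles_sleep h2).trans_lt h)]
            simp
          · simp
  rw [stabProb]
  refine (iSup_congr fun n => ?_).trans ciSup_const
  convert key n ω h

/-- A new particle can die before doing anything else. -/
theorem IsHarmonic.add_pos {A : ARWData V} {v : ARWConfig V → ℝ} (hv : A.IsHarmonic v)
    (h0 : ∀ ω, 0 ≤ v ω) {ω : ARWConfig V} (hω : ∀ x, ω x ≠ SiteState.s) (hpos : 0 < v ω) (x : V) :
    0 < v (ω.add x) := by
  have hr := A.rate_pos
  by_contra! hx
  refine A.K_nondegenerate (Finset.univ.filter fun z => v (ω.add z) ≤ 0) ⟨x, by simpa using hx⟩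
    fun z hz => ?_
  have hz : v (ω.add z) ≤ 0 := by simpa using hz
  have key := A.topple_eq z v (ω.add z)
  have hk : (ω.add z).kill z = ω := by
    have := hω z
    rw [ARWConfig.kill, ARWConfig.add]
    simp only [Function.update_self, Function.update_idem]
    convert Function.update_eq_self z ω
    generalize ω z = t at this
    rcases t with _ | k <;> simp_all [SiteState.arrive, SiteState.leave]
  rw [hv.topple_eq (ω.add z) z (by
    rw [ARWConfig.add_apply, if_pos rfl]
    exact Nat.succ_pos _ |>.trans_le (ω z).active_le_arrive)] at key
  simp only [ARWConfig.jump, hk] at key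
  have h1 : ∀ y, 0 ≤ A.K z y * v (ω.add y) := fun y => mul_nonneg (A.K_nonneg z y) (h0 _)
  have h2 : 0 ≤ ∑ y, A.K z y * v (ω.add y) := Finset.sum_nonneg fun y _ => h1 y
  have h3 : 0 ≤ (1 - ∑ y, A.K z y) * v ω := mul_nonneg (by linarith [A.K_row_le z]) hpos.le
  have h4 := mul_nonneg hr.le (h0 (Function.update (ω.add z) z (ω.add z z).doze))
  have h5 : (1 + A.rate) * v (ω.add z) ≤ 0 := mul_nonpos_of_nonneg_of_nonpos (by linarith) hz
  have h6 : ∑ y, A.K z y * v (ω.add y) = 0 := by linarith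
  have h7 : ∑ y, A.K z y = 1 := by
    rcases mul_eq_zero.1 (show (1 - ∑ y, A.K z y) * v ω = 0 by linarith) with h | h
    · linarith
    · exact absurd h hpos.ne'
  rw [← h7]
  refine Finset.sum_subset (Finset.filter_subset _ _) fun y _ hy => ?_
  have hy : 0 < v (ω.add y) := by simpa using hy
  have := (Finset.sum_eq_zero_iff_of_nonneg fun y _ => h1 y).1 h6 y (Finset.mem_univ y)
  exact (mul_eq_zero.1 this).resolve_right hy.ne'

theorem stabProb_ofFinset_univ_pos (A : ARWData V) (ξ : SleepConfig V) :
    0 < A.stabProb (.ofFinset Finset.univ) ξ := by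
  have hr := A.rate_pos
  have hv := A.isHarmonic_stabProb ξ
  set R : Finset V := Finset.univ.filter fun x => ξ x = true
  -- the active particles on the support of `ξ` can all fall asleep
  have h1 : ∀ T ⊆ R,
      0 < A.stabProb (fun x => if x ∈ T then SiteState.num 1 else ξ.toConfig x) ξ := by
    intro T
    induction T using Finset.induction_on with
    | empty => simp [stabProb_toConfig]
    | insert x T hx ih =>
      intro hT
      have hxR : ξ x = true := by
        simpa [R] using hT (Finset.mem_insert_self x T)
      set ω : ARWConfig V := fun z => if z ∈ insert x T then SiteState.num 1 else ξ.toConfig z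
      have hω : ω x = SiteState.num 1 := by simp [ω]
      have e : ω.execute x none = fun z => if z ∈ T then SiteState.num 1 else ξ.toConfig z := by
        ext z
        by_cases h : z = x
        · subst h
          simp [ARWConfig.execute, hω, SiteState.doze, hx, SleepConfig.toConfig, hxR]
        · simp [ARWConfig.execute, ω, h]
      have ht := hv.topple_eq ω x (by simp [hω, SiteState.active])
      rw [← ht]
      refine Finset.sum_pos' (fun i _ => mul_nonneg (A.weight_nonneg x i) (A.stabProb_nonneg _ _))
        ⟨none, Finset.mem_univ _, mul_pos ?_ ?_⟩
      · simp only [weight]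
        positivity
      · rw [e]
        exact ih ((Finset.subset_insert x T).trans hT)
  -- and the particles outside the support of `ξ` can all die
  have h2 : ∀ D : Finset V, 0 < A.stabProb (.ofFinset (R ∪ D)) ξ := by
    intro D
    induction D using Finset.induction_on with
    | empty =>
      convert h1 R subset_rfl using 2
      ext x
      by_cases h : ξ x = true <;> simp [ARWConfig.ofFinset, R, SleepConfig.toConfig, h]
    | insert x D hx ih =>
      rw [Finset.union_insert]
      by_cases h : x ∈ R ∪ D
      · rwa [Finset.insert_eq_of_mem h]
      · rw [← ARWConfig.ofFinset_add h]
        refine hv.add_pos (fun ω => A.stabProb_nonneg ω ξ) (fun z => ?_) ih x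
        rw [ARWConfig.ofFinset]
        split_ifs <;> simp
  have := h2 Finset.univ
  rwa [Finset.union_eq_right.2 (Finset.subset_univ R)] at this

theorem P_apply (A : ARWData V) (η ξ : SleepConfig V) :
    A.P η ξ = A.ins (fun ω => A.stabProb ω ξ) η.toConfig := rfl

theorem IsHarmonic.sum_P {A : ARWData V} {v : ARWConfig V → ℝ} (hv : A.IsHarmonic v)
    (η : SleepConfig V) : ∑ ζ, A.P η ζ * v ζ.toConfig = A.ins v η.toConfig := by
  simp only [P_apply, ARWData.ins, Finset.sum_mul]
  rw [Finset.sum_comm]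
  refine Finset.sum_congr rfl fun x _ => ?_
  rw [hv.eq_sum (η.toConfig.add x), Finset.mul_sum]
  exact Finset.sum_congr rfl fun ζ _ => by ring

/-- Stabilizing after each insertion, or only once at the end, amounts to the same. -/
theorem P_pow_apply (A : ARWData V) (t : ℕ) (η ξ : SleepConfig V) :
    (A.P ^ t) η ξ = A.ins^[t] (fun ω => A.stabProb ω ξ) η.toConfig := by
  induction t generalizing η with
  | zero => simp [Matrix.one_apply, stabProb_toConfig]
  | succ t ih =>
    rw [pow_succ', Matrix.mul_apply, Function.iterate_succ_apply',
      ← ((A.isHarmonic_stabProb ξ).ins_iterate t).sum_P η]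
    exact Finset.sum_congr rfl fun ζ _ => by rw [ih]

theorem P_nonneg (A : ARWData V) (η ξ : SleepConfig V) : 0 ≤ A.P η ξ :=
  Finset.sum_nonneg fun x _ => mul_nonneg (A.nu_nonneg x) (A.stabProb_nonneg _ _)

theorem P_sum (A : ARWData V) (η : SleepConfig V) : ∑ ξ, A.P η ξ = 1 := by
  have := (A.isHarmonic_const 1).sum_P η
  simpa [ins, A.nu_sum] using this

theorem isInvariant_stabProb (A : ARWData V) :
    A.IsInvariant fun ξ => A.stabProb (.ofFinset Finset.univ) ξ := by
  refine ⟨fun ξ => A.stabProb_nonneg _ _, ?_, ?_⟩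
  · have := (A.isHarmonic_const 1).eq_sum (.ofFinset Finset.univ)
    simpa using this.symm
  · ext ξ
    have hu := A.isHarmonic_stabProb ξ
    have := hu.ins.eq_sum (.ofFinset Finset.univ)
    rw [hu.ins_ofFinset] at this
    simp only [Finset.compl_univ, Finset.sum_empty, add_zero] at this
    rw [this]
    simp only [Matrix.vecMul, dotProduct, P_apply]
    exact Finset.sum_congr rfl fun η _ => mul_comm _ _

end ARWData

/-! ### Internal DLA and the separation distance -/

namespace ARWData

variable {V : Type*} [Fintype V]

theorem nonempty (A : ARWData V) : Nonempty V := by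
  by_contra h
  rw [not_nonempty_iff] at h
  simpa using A.nu_sum

variable [DecidableEq V]

theorem erase_ne_univ (y : V) : Finset.univ.erase y ≠ Finset.univ := fun h =>
  Finset.notMem_erase y Finset.univ (by rw [h]; exact Finset.mem_univ y)

/-- The transition operator of internal DLA, a Markov chain on the subsets of `V` which can only
grow, by one site at a time. -/
noncomputable def idla (A : ARWData V) (f : Finset V → ℝ) (S : Finset V) : ℝ :=
  f S + ∑ y ∈ Sᶜ, A.growth S y * (f (insert y S) - f S)

theorem idla_eq (A : ARWData V) (f : Finset V → ℝ) (S : Finset V) :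
    A.idla f S = (1 - ∑ y ∈ Sᶜ, A.growth S y) * f S + ∑ y ∈ Sᶜ, A.growth S y * f (insert y S) := by
  simp only [idla, mul_sub, Finset.sum_sub_distrib, ← Finset.sum_mul]
  ring

theorem idla_mono (A : ARWData V) : Monotone A.idla := by
  intro f g h S
  rw [idla_eq, idla_eq]
  refine add_le_add (mul_le_mul_of_nonneg_left (h S) ?_) (Finset.sum_le_sum fun y _ =>
    mul_le_mul_of_nonneg_left (h _) (A.growth_nonneg S y))
  linarith [A.sum_growth_le_one S]

theorem idla_const (A : ARWData V) (c : ℝ) (S : Finset V) : A.idla (fun _ => c) S = c := by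
  simp [idla]

theorem idla_const_mul (A : ARWData V) (c : ℝ) (f : Finset V → ℝ) (S : Finset V) :
    A.idla (fun T => c * f T) S = c * A.idla f S := by
  simp only [idla, mul_add, Finset.mul_sum]
  congr 1
  exact Finset.sum_congr rfl fun y _ => by ring

/-- The probability that internal DLA started from `S` has not filled `V` after `t` steps. -/
noncomputable def tail (A : ARWData V) (t : ℕ) : Finset V → ℝ :=
  A.idla^[t] fun S => if S = Finset.univ then 0 else 1

theorem tail_zero (A : ARWData V) (S : Finset V) :
    A.tail 0 S = if S = Finset.univ then 0 else 1 := rfl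

theorem tail_succ (A : ARWData V) (t : ℕ) : A.tail (t + 1) = A.idla (A.tail t) :=
  Function.iterate_succ_apply' _ _ _

theorem tail_univ (A : ARWData V) (t : ℕ) : A.tail t Finset.univ = 0 := by
  induction t with
  | zero => simp [tail_zero]
  | succ t ih => simp [tail_succ, idla, ih]

theorem tail_mem_Icc (A : ARWData V) (t : ℕ) (S : Finset V) :
    0 ≤ A.tail t S ∧ A.tail t S ≤ 1 := by
  induction t generalizing S with
  | zero =>
    rw [tail_zero]
    split_ifs <;> norm_num
  | succ t ih =>
    rw [tail_succ]
    exact ⟨(A.idla_const 0 S).symm.le.trans (A.idla_mono (fun T => (ih T).1) S),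
      (A.idla_mono (fun T => (ih T).2) S).trans (A.idla_const 1 S).le⟩

theorem tail_succ_le (A : ARWData V) (t : ℕ) : A.tail (t + 1) ≤ A.tail t := by
  induction t with
  | zero =>
    intro S
    by_cases h : S = Finset.univ
    · rw [h, tail_univ, tail_univ]
    · rw [A.tail_zero S, if_neg h]
      exact (A.tail_mem_Icc _ S).2
  | succ t ih =>
    rw [A.tail_succ (t + 1)]
    conv_rhs => rw [A.tail_succ t]
    exact A.idla_mono ih

theorem tail_antitone (A : ARWData V) (S : Finset V) : Antitone fun t => A.tail t S :=
  antitone_nat_of_succ_le fun t => A.tail_succ_le t S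

theorem tail_eq_one (A : ARWData V) (t : ℕ) {S : Finset V} (h : t + S.card < Fintype.card V) :
    A.tail t S = 1 := by
  induction t generalizing S with
  | zero =>
    rw [tail_zero, if_neg]
    rintro rfl
    simp at h
  | succ t ih =>
    rw [tail_succ, idla, ih (by omega)]
    rw [Finset.sum_eq_zero, add_zero]
    intro y hy
    rw [ih, sub_self, mul_zero]
    rw [Finset.card_insert_of_notMem (Finset.mem_compl.1 hy)]
    omega

/-- The configuration in which all sites carry a sleeping particle. It cannot be attained from the
empty configuration unless internal DLA has filled `V`. -/
def allAsleep (V : Type*) : SleepConfig V := fun _ => true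

theorem stabProb_allAsleep (A : ARWData V) {S : Finset V} (hS : S ≠ Finset.univ) :
    A.stabProb (.ofFinset S) (allAsleep V) = 0 := by
  refine A.stabProb_eq_zero_of_lt ?_
  have h1 : ∀ x, (ARWConfig.ofFinset S x).count = if x ∈ S then 1 else 0 := fun x => by
    rw [ARWConfig.ofFinset]
    split_ifs <;> rfl
  have h2 : (ARWConfig.ofFinset S).numParticles = S.card := by
    simp [ARWConfig.numParticles, h1]
  have h3 : (allAsleep V).toConfig.numParticles = Fintype.card V := by
    simp [ARWConfig.numParticles, SleepConfig.toConfig, allAsleep, SiteState.count]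
  rw [h2, h3]
  exact lt_of_le_of_ne (Finset.card_le_univ S) fun h => hS ((Finset.card_eq_iff_eq_univ S).1 h)

theorem ins_iterate_allAsleep (A : ARWData V) (t : ℕ) (S : Finset V) :
    A.ins^[t] (fun ω => A.stabProb ω (allAsleep V)) (.ofFinset S) =
      (1 - A.tail t S) * A.stabProb (.ofFinset Finset.univ) (allAsleep V) := by
  induction t generalizing S with
  | zero =>
    rw [tail_zero]
    split_ifs with h
    · simp [h]
    · simp [A.stabProb_allAsleep h]
  | succ t ih =>
    rw [Function.iterate_succ_apply', ((A.isHarmonic_stabProb _).ins_iterate t).ins_ofFinset,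
      tail_succ, idla]
    simp only [ih]
    have e : ∀ c : ℝ, ∑ y ∈ Sᶜ, A.growth S y * ((1 - A.tail t (insert y S)) * c -
        (1 - A.tail t S) * c) =
        -(∑ y ∈ Sᶜ, A.growth S y * (A.tail t (insert y S) - A.tail t S)) * c := fun c => by
      rw [← Finset.sum_neg_distrib, Finset.sum_mul]
      exact Finset.sum_congr rfl fun y _ => by ring
    rw [e]
    ring

/-- The time at which internal DLA fills the sites is a strong stationary time: the particles
which are present initially may only help. -/
theorem le_ins_iterate (A : ARWData V) (ξ : SleepConfig V) (t : ℕ) {S : Finset V}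
    {ω : ARWConfig V} (hω : ω.ActiveOn S) :
    (1 - A.tail t S) * A.stabProb (.ofFinset Finset.univ) ξ ≤
      A.ins^[t] (fun ω => A.stabProb ω ξ) ω := by
  have hv := A.isHarmonic_stabProb ξ
  induction t generalizing S ω with
  | zero =>
    rw [tail_zero]
    split_ifs with h
    · subst h
      simp [hv.eq_ofFinset_univ hω]
    · simpa using A.stabProb_nonneg ω ξ
  | succ t ih =>
    rw [Function.iterate_succ_apply', (hv.ins_iterate t).ins_eq hω, tail_succ, idla_eq]
    set v := A.ins^[t] fun ω => A.stabProb ω ξ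
    set c := A.stabProb (.ofFinset Finset.univ) ξ
    have h1 := mul_le_mul_of_nonneg_left (ih hω) (sub_nonneg.2 (A.sum_growth_le_one S))
    have h2 := Finset.sum_le_sum fun y (_ : y ∈ Sᶜ) =>
      mul_le_mul_of_nonneg_left (ih (hω.insert y)) (A.growth_nonneg S y)
    simp only [mul_sub, sub_mul, one_mul, Finset.sum_sub_distrib, ← Finset.sum_mul,
      ← mul_assoc] at h1 h2 ⊢
    linarith

theorem tail_le_tail_empty (A : ARWData V) (t : ℕ) (S : Finset V) : A.tail t S ≤ A.tail t ∅ := by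
  have h := A.le_ins_iterate (allAsleep V) t (S := ∅) (ω := .ofFinset S)
    (by simp [ARWConfig.ActiveOn])
  rw [ins_iterate_allAsleep] at h
  have := le_of_mul_le_mul_right h (A.stabProb_ofFinset_univ_pos _)
  linarith

theorem exists_le_sum_growth (A : ARWData V) :
    ∃ p, 0 < p ∧ ∀ S : Finset V, S ≠ Finset.univ → p ≤ ∑ y ∈ Sᶜ, A.growth S y := by
  obtain ⟨S, hS, h⟩ := Finset.exists_min_image
    (Finset.univ.filter fun S : Finset V => S ≠ Finset.univ) (fun S => ∑ y ∈ Sᶜ, A.growth S y)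
    ⟨∅, by
      have := A.nonempty
      simpa using Finset.univ_nonempty.ne_empty.symm⟩
  exact ⟨_, A.sum_growth_pos (by simpa using hS), fun T hT => h T (by simpa using hT)⟩

theorem summable_tail (A : ARWData V) (S : Finset V) : Summable fun t => A.tail t S := by
  obtain ⟨p, hp, h⟩ := A.exists_le_sum_growth
  -- each missing site costs at most `1 / p` steps on average
  have key : ∀ n, ∀ S : Finset V, ∑ t ∈ Finset.range n, A.tail t S ≤ (Sᶜ.card : ℝ) / p := by
    intro n
    induction n with
    | zero =>
      intro S
      rw [Finset.sum_range_zero]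
      positivity
    | succ n ih =>
      intro S
      by_cases hS : S = Finset.univ
      · subst hS
        simp [tail_univ]
      have e : ∑ t ∈ Finset.range n, A.idla (A.tail t) S =
          A.idla (fun T => ∑ t ∈ Finset.range n, A.tail t T) S := by
        simp only [idla, Finset.sum_add_distrib, ← Finset.sum_sub_distrib, Finset.mul_sum]
        rw [Finset.sum_comm]
      have hm := A.idla_mono ih S
      rw [Finset.sum_range_succ', tail_zero, if_neg hS]
      simp only [tail_succ, e]
      refine (add_le_add_left hm 1).trans ?_
      have h1 : ∀ y ∈ Sᶜ, A.growth S y * ((((insert y S)ᶜ).card : ℝ) / p - (Sᶜ.card : ℝ) / p) =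
          - (A.growth S y * (1 / p)) := by
        intro y hy
        have : Sᶜ.card = (insert y S)ᶜ.card + 1 := by
          rw [Finset.compl_insert, Finset.card_erase_add_one hy]
        rw [this]
        push_cast
        ring
      rw [idla, Finset.sum_congr rfl h1, Finset.sum_neg_distrib, ← Finset.sum_mul]
      have h2 : 1 ≤ (∑ y ∈ Sᶜ, A.growth S y) * (1 / p) := by
        rw [mul_one_div, one_le_div hp]
        exact h S hS
      linarith
  exact summable_of_sum_range_le (fun t => (A.tail_mem_Icc t S).1) fun n => key n S

theorem tendsto_tail (A : ARWData V) (S : Finset V) :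
    Tendsto (fun t => A.tail t S) atTop (𝓝 0) := (A.summable_tail S).tendsto_atTop_zero

theorem le_P_pow (A : ARWData V) (t : ℕ) (η ξ : SleepConfig V) :
    (1 - A.tail t ∅) * A.stabProb (.ofFinset Finset.univ) ξ ≤ (A.P ^ t) η ξ := by
  rw [P_pow_apply]
  exact A.le_ins_iterate ξ t (by simp [ARWConfig.ActiveOn])

theorem IsInvariant.eq {A : ARWData V} {μ : SleepConfig V → ℝ} (hμ : A.IsInvariant μ) :
    μ = fun ξ => A.stabProb (.ofFinset Finset.univ) ξ := by
  obtain ⟨h0, h1, h2⟩ := hμ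
  have hpow : ∀ t : ℕ, Matrix.vecMul μ (A.P ^ t) = μ := by
    intro t
    induction t with
    | zero => simp
    | succ t ih => rw [pow_succ, ← Matrix.vecMul_vecMul, ih, h2]
  have hle : ∀ ξ, A.stabProb (.ofFinset Finset.univ) ξ ≤ μ ξ := by
    intro ξ
    have ht : Tendsto (fun t => (1 - A.tail t ∅) * A.stabProb (.ofFinset Finset.univ) ξ) atTop
        (𝓝 ((1 - 0) * A.stabProb (.ofFinset Finset.univ) ξ)) :=
      ((A.tendsto_tail ∅).const_sub 1).mul_const _
    rw [sub_zero, one_mul] at ht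
    refine le_of_tendsto' ht fun t => ?_
    rw [← congrFun (hpow t) ξ, Matrix.vecMul, dotProduct]
    calc _ = ∑ η, μ η * ((1 - A.tail t ∅) * A.stabProb (.ofFinset Finset.univ) ξ) := by
          rw [← Finset.sum_mul, h1, one_mul]
      _ ≤ _ := Finset.sum_le_sum fun η _ =>
          mul_le_mul_of_nonneg_left (A.le_P_pow t η ξ) (h0 η)
  have hsum : ∑ ξ, (μ ξ - A.stabProb (.ofFinset Finset.univ) ξ) = 0 := by
    rw [Finset.sum_sub_distrib, h1, A.isInvariant_stabProb.2.1, sub_self]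
  ext ξ
  have := (Finset.sum_eq_zero_iff_of_nonneg fun ξ _ => sub_nonneg.2 (hle ξ)).1 hsum ξ
    (Finset.mem_univ ξ)
  linarith

theorem existsUnique_isInvariant (A : ARWData V) : ∃! π, A.IsInvariant π :=
  ⟨_, A.isInvariant_stabProb, fun _ h => h.eq⟩

/-- Exact sampling: the invariant distribution is the law of the stabilization of the configuration
with one active particle per site. -/
theorem stat_eq (A : ARWData V) : A.stat = fun ξ => A.stabProb (.ofFinset Finset.univ) ξ :=
  (Classical.epsilon_spec ⟨_, A.isInvariant_stabProb⟩ : A.IsInvariant A.stat).eq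

theorem isInvariant_stat (A : ARWData V) : A.IsInvariant A.stat := by
  rw [stat_eq]
  exact A.isInvariant_stabProb

theorem stat_pos (A : ARWData V) (ξ : SleepConfig V) : 0 < A.stat ξ := by
  rw [stat_eq]
  exact A.stabProb_ofFinset_univ_pos ξ

/-- The strong stationary time is optimal. -/
theorem dsep_eq (A : ARWData V) (t : ℕ) : A.dsep t = A.tail t ∅ := by
  refine le_antisymm (ciSup_le fun q => ?_) ?_
  · have h := A.le_P_pow t q.1 q.2
    rw [show A.stabProb (.ofFinset Finset.univ) q.2 = A.stat q.2 by rw [stat_eq]] at h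
    have := (le_div_iff₀ (A.stat_pos q.2)).2 h
    linarith
  · refine le_ciSup_of_le (Set.finite_range _).bddAbove (⟨fun _ => false, allAsleep V⟩ :
      SleepConfig V × SleepConfig V) ?_
    have e : (SleepConfig.toConfig fun _ : V => false) = .ofFinset ∅ := by
      ext x
      simp [SleepConfig.toConfig, ARWConfig.ofFinset]
    have h := A.stat_pos (allAsleep V)
    simp only [P_pow_apply, e, ins_iterate_allAsleep]
    rw [stat_eq] at h ⊢
    rw [mul_div_cancel_right₀ _ h.ne']
    linarith

/-! ### The spectrum -/

theorem hasEigenvalue_iff_vecMul {n : Type*} [Fintype n] [DecidableEq n] (M : Matrix n n ℂ)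
    (z : ℂ) : Module.End.HasEigenvalue (Matrix.toLin' M) z ↔
      ∃ w ≠ 0, Matrix.vecMul w M = z • w := by
  have h1 : Module.End.HasEigenvalue (Matrix.toLin' M) z ↔
      ∃ w ≠ 0, Matrix.mulVec (M - z • 1) w = 0 := by
    constructor
    · intro h
      obtain ⟨w, hw⟩ := h.exists_hasEigenvector
      refine ⟨w, hw.2, ?_⟩
      have := hw.apply_eq_smul
      rw [Matrix.toLin'_apply] at this
      rw [Matrix.sub_mulVec, this, Matrix.smul_mulVec, Matrix.one_mulVec, sub_self]
    · rintro ⟨w, hw, h⟩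
      rw [Matrix.sub_mulVec, Matrix.smul_mulVec, Matrix.one_mulVec, sub_eq_zero] at h
      refine Module.End.hasEigenvalue_of_hasEigenvector (x := w) ⟨?_, hw⟩
      rw [Module.End.mem_eigenspace_iff, Matrix.toLin'_apply, h]
  rw [h1, Matrix.exists_mulVec_eq_zero_iff, ← Matrix.exists_vecMul_eq_zero_iff]
  simp only [Matrix.vecMul_sub, Matrix.vecMul_smul, Matrix.vecMul_one, sub_eq_zero]

/-- The difference between the stabilizations of the configurations `V ∖ {y}` and `V` is a left
eigenvector. -/
theorem hasEigenvalue_growth (A : ARWData V) (y : V) :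
    Module.End.HasEigenvalue (Matrix.toLin' (A.P.map (fun a : ℝ => (a : ℂ))))
      ((1 - A.growth (Finset.univ.erase y) y : ℝ) : ℂ) := by
  rw [hasEigenvalue_iff_vecMul]
  set T : Finset V := Finset.univ.erase y with hT
  have hTc : Tᶜ = {y} := by simp [hT]
  have hTi : insert y T = Finset.univ := by simp [hT]
  refine ⟨fun ξ => ((A.stabProb (.ofFinset T) ξ - A.stabProb (.ofFinset Finset.univ) ξ : ℝ) : ℂ),
    fun h => ?_, ?_⟩
  · have h := congrFun h (allAsleep V)
    simp only [A.stabProb_allAsleep (S := T) (erase_ne_univ y), Pi.zero_apply,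
      Complex.ofReal_eq_zero] at h
    linarith [A.stabProb_ofFinset_univ_pos (allAsleep V)]
  · ext ξ
    have hu := A.isHarmonic_stabProb ξ
    have h1 := hu.ins.eq_sum (.ofFinset T)
    have h2 := hu.ins.eq_sum (.ofFinset Finset.univ)
    rw [hu.ins_ofFinset, hTc, Finset.sum_singleton, hTi] at h1
    rw [hu.ins_ofFinset] at h2
    simp only [Finset.compl_univ, Finset.sum_empty, add_zero] at h2
    have h3 : ∑ η, (A.stabProb (.ofFinset T) η - A.stabProb (.ofFinset Finset.univ) η) * A.P η ξ =
        (1 - A.growth T y) *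
          (A.stabProb (.ofFinset T) ξ - A.stabProb (.ofFinset Finset.univ) ξ) := by
      simp only [P_apply, sub_mul _ _ (A.ins _ _), Finset.sum_sub_distrib]
      rw [← Finset.sum_congr rfl fun η _ => mul_comm _ (A.stabProb (.ofFinset T) η), ← h1,
        ← Finset.sum_congr rfl fun η _ => mul_comm _ (A.stabProb (.ofFinset Finset.univ) η), ← h2]
      ring
    simp only [Matrix.vecMul, dotProduct, Matrix.map_apply, Pi.smul_apply, smul_eq_mul]
    exact_mod_cast h3

/-- The `t`-step transition matrix is a mixture, with weight `dsep t` on the part which is not at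
equilibrium, and only this part acts on an eigenvector. -/
theorem norm_pow_le_dsep (A : ARWData V) {z : ℂ} (hz : z ≠ 1)
    (h : Module.End.HasEigenvalue (Matrix.toLin' (A.P.map (fun a : ℝ => (a : ℂ)))) z) (t : ℕ) :
    ‖z‖ ^ t ≤ A.dsep t := by
  obtain ⟨w, hw⟩ := h.exists_hasEigenvector
  set M : Matrix (SleepConfig V) (SleepConfig V) ℂ := A.P.map (fun a : ℝ => (a : ℂ)) with hM
  have h1 : Matrix.mulVec M w = z • w := by
    simpa [Matrix.toLin'_apply] using hw.apply_eq_smul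
  have hpow : ∀ t : ℕ, Matrix.mulVec (M ^ t) w = z ^ t • w := by
    intro t
    induction t with
    | zero => simp
    | succ t ih => rw [pow_succ, ← Matrix.mulVec_mulVec, h1, Matrix.mulVec_smul, ih, smul_smul,
        pow_succ']
  have hMpow : ∀ t : ℕ, M ^ t = (A.P ^ t).map (fun a : ℝ => (a : ℂ)) := fun t =>
    (Matrix.map_pow A.P Complex.ofRealHom t).symm
  have hpi : ∑ ξ, (A.stat ξ : ℂ) * w ξ = 0 := by
    have e : Matrix.vecMul (fun ξ => (A.stat ξ : ℂ)) M = fun ξ => (A.stat ξ : ℂ) := by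
      ext ξ
      have := congrFun A.isInvariant_stat.2.2 ξ
      simp only [Matrix.vecMul, dotProduct, hM, Matrix.map_apply] at this ⊢
      exact_mod_cast this
    have := Matrix.dotProduct_mulVec (fun ξ => (A.stat ξ : ℂ)) M w
    rw [e, h1, dotProduct_smul, smul_eq_mul] at this
    have h2 : (z - 1) * ((fun ξ => (A.stat ξ : ℂ)) ⬝ᵥ w) = 0 := by linear_combination this
    exact (mul_eq_zero.1 h2).resolve_left (sub_ne_zero.2 hz)
  obtain ⟨η, -, hη⟩ := Finset.exists_max_image Finset.univ (fun η => ‖w η‖)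
    ⟨allAsleep V, Finset.mem_univ _⟩
  have hpos : 0 < ‖w η‖ := by
    by_contra! h0
    refine hw.2 (funext fun ξ => ?_)
    exact norm_le_zero_iff.1 ((hη ξ (Finset.mem_univ ξ)).trans h0)
  set s := A.dsep t with hs
  have hq : ∀ ξ, 0 ≤ (A.P ^ t) η ξ - (1 - s) * A.stat ξ := fun ξ => by
    have := A.le_P_pow t η ξ
    rw [hs, dsep_eq, stat_eq]
    linarith
  have hrow : ∑ ξ, (A.P ^ t) η ξ = 1 := by
    clear_value s
    clear hq hs
    induction t generalizing η with
    | zero => simp [Matrix.one_apply]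
    | succ t ih =>
      simp only [pow_succ, Matrix.mul_apply]
      rw [Finset.sum_comm]
      simp only [← Finset.mul_sum, A.P_sum, mul_one]
      exact ih η ‹_› ‹_›
  have hqs : ∑ ξ, ((A.P ^ t) η ξ - (1 - s) * A.stat ξ) = s := by
    rw [Finset.sum_sub_distrib, hrow, ← Finset.mul_sum, A.isInvariant_stat.2.1]
    ring
  have hmain : z ^ t * w η = ∑ ξ, (((A.P ^ t) η ξ - (1 - s) * A.stat ξ : ℝ) : ℂ) * w ξ := by
    have := congrFun (hpow t) η
    rw [hMpow] at this
    simp only [Matrix.mulVec, dotProduct, Matrix.map_apply, Pi.smul_apply, smul_eq_mul] at this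
    push_cast
    simp only [sub_mul _ _ (w _), Finset.sum_sub_distrib, this, mul_assoc, ← Finset.mul_sum, hpi,
      mul_zero, sub_zero]
  have : ‖z‖ ^ t * ‖w η‖ ≤ s * ‖w η‖ := by
    rw [← norm_pow, ← norm_mul, hmain]
    conv_rhs => rw [← hqs, Finset.sum_mul]
    refine (norm_sum_le _ _).trans (Finset.sum_le_sum fun ξ _ => ?_)
    rw [norm_mul, Complex.norm_real, Real.norm_of_nonneg (hq ξ)]
    exact mul_le_mul_of_nonneg_left (hη ξ (Finset.mem_univ ξ)) (hq ξ)
  exact le_of_mul_le_mul_right this hpos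

theorem growth_erase_pos (A : ARWData V) (y : V) : 0 < A.growth (Finset.univ.erase y) y := by
  simpa using A.sum_growth_pos (erase_ne_univ y)

theorem growth_le_one (A : ARWData V) (y : V) : A.growth (Finset.univ.erase y) y ≤ 1 := by
  simpa using A.sum_growth_le_one (Finset.univ.erase y)

theorem growth_mem_eigModuli (A : ARWData V) (y : V) :
    1 - A.growth (Finset.univ.erase y) y ∈ A.eigModuli := by
  refine ⟨_, ?_, A.hasEigenvalue_growth y, ?_⟩
  · have := A.growth_erase_pos y
    exact_mod_cast (show 1 - A.growth (Finset.univ.erase y) y ≠ 1 by linarith)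
  · rw [Complex.norm_real, Real.norm_of_nonneg]
    linarith [A.growth_le_one y]

theorem eigModuli_finite (A : ARWData V) : A.eigModuli.Finite := by
  refine ((Module.End.finite_hasEigenvalue
    (Matrix.toLin' (A.P.map (fun a : ℝ => (a : ℂ))))).image fun z => ‖z‖).subset ?_
  rintro r ⟨z, -, hz, rfl⟩
  exact ⟨z, hz, rfl⟩

theorem isGreatest_rho (A : ARWData V) : IsGreatest A.eigModuli A.rho := by
  obtain ⟨y⟩ := A.nonempty
  exact ⟨Set.Nonempty.csSup_mem ⟨_, A.growth_mem_eigModuli y⟩ A.eigModuli_finite,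
    fun r hr => le_csSup A.eigModuli_finite.bddAbove hr⟩

theorem rho_pow_le_dsep (A : ARWData V) (t : ℕ) : A.rho ^ t ≤ A.dsep t := by
  obtain ⟨z, hz, h, e⟩ := A.isGreatest_rho.1
  rw [e]
  exact A.norm_pow_le_dsep hz h t

theorem rho_nonneg (A : ARWData V) : 0 ≤ A.rho := by
  obtain ⟨z, -, -, e⟩ := A.isGreatest_rho.1
  rw [e]
  exact norm_nonneg z

theorem tendsto_dsep (A : ARWData V) : Tendsto A.dsep atTop (𝓝 0) := by
  simpa only [funext A.dsep_eq] using A.tendsto_tail ∅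

theorem rho_lt_one (A : ARWData V) : A.rho < 1 := by
  by_contra! h
  obtain ⟨t, ht⟩ := (A.tendsto_dsep.eventually (gt_mem_nhds one_pos)).exists
  exact absurd ((one_le_pow₀ h).trans (A.rho_pow_le_dsep t)) (not_le.2 ht)

theorem one_le_trel (A : ARWData V) : 1 ≤ A.trel := by
  rw [trel, one_le_div (by linarith [A.rho_lt_one])]
  linarith [A.rho_nonneg]

theorem one_le_trel_mul_growth (A : ARWData V) (y : V) :
    1 ≤ A.trel * A.growth (Finset.univ.erase y) y := by
  have h := A.isGreatest_rho.2 (A.growth_mem_eigModuli y)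
  have h1 : 0 < 1 - A.rho := by linarith [A.rho_lt_one]
  rw [trel, one_div_mul_eq_div, one_le_div h1]
  linarith

end ARWData

/-! ### Mean filling times -/

namespace ARWData

variable {V : Type*} [Fintype V] [DecidableEq V]

/-- An abelian-harmonic extension to all configurations of the truncated mean filling times
`S ↦ ∑ t ∈ Finset.range n, A.tail t S`. -/
noncomputable def truncTime (A : ARWData V) (n : ℕ) (ω : ARWConfig V) : ℝ :=
  n - ∑ t ∈ Finset.range n, (A.stabProb (.ofFinset Finset.univ) (allAsleep V))⁻¹ *
    A.ins^[t] (fun ω => A.stabProb ω (allAsleep V)) ω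

theorem isHarmonic_truncTime (A : ARWData V) (n : ℕ) : A.IsHarmonic (A.truncTime n) :=
  (A.isHarmonic_const n).sub (IsHarmonic.sum _ _ fun t =>
    (A.isHarmonic_stabProb (allAsleep V)).ins_iterate t)

theorem truncTime_ofFinset (A : ARWData V) (n : ℕ) (S : Finset V) :
    A.truncTime n (.ofFinset S) = ∑ t ∈ Finset.range n, A.tail t S := by
  have h := (A.stabProb_ofFinset_univ_pos (allAsleep V)).ne'
  have e : ∀ t, (A.stabProb (.ofFinset Finset.univ) (allAsleep V))⁻¹ *
      A.ins^[t] (fun ω => A.stabProb ω (allAsleep V)) (.ofFinset S) = 1 - A.tail t S := fun t => by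
    rw [ins_iterate_allAsleep, mul_comm, mul_assoc, mul_inv_cancel₀ h, mul_one]
  simp [truncTime, e]

theorem truncTime_succ (A : ARWData V) (n : ℕ) (ω : ARWConfig V) :
    A.truncTime (n + 1) ω = A.truncTime 1 ω + A.ins (A.truncTime n) ω := by
  simp only [truncTime, ins, mul_sub, Finset.sum_sub_distrib, ← Finset.sum_mul, A.nu_sum,
    Finset.sum_range_succ' _ n, Finset.sum_range_one, Function.iterate_zero, id,
    Function.iterate_succ_apply', Finset.mul_sum]
  rw [Finset.sum_comm]
  have : ∀ t x, (A.stabProb (.ofFinset Finset.univ) (allAsleep V))⁻¹ * (A.nu x *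
      A.ins^[t] (fun ω => A.stabProb ω (allAsleep V)) (ω.add x)) = A.nu x *
      ((A.stabProb (.ofFinset Finset.univ) (allAsleep V))⁻¹ *
      A.ins^[t] (fun ω => A.stabProb ω (allAsleep V)) (ω.add x)) := fun t x => by ring
  simp only [this]
  push_cast
  ring

/-- One additional initial particle saves at most `trel` steps on average. By the abelian property
it may be kept aside until internal DLA has filled all sites but one, and then what remains to be
waited for is the first visit to this site. -/
theorem truncTime_sub_add (A : ARWData V) (n : ℕ) (S : Finset V) (y : V) :
    0 ≤ A.truncTime n (.ofFinset S) - A.truncTime n ((ARWConfig.ofFinset S).add y) ∧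
      A.truncTime n (.ofFinset S) - A.truncTime n ((ARWConfig.ofFinset S).add y) ≤ A.trel := by
  have hC : 0 ≤ A.trel := zero_le_one.trans A.one_le_trel
  induction n generalizing S y with
  | zero => simpa [truncTime] using hC
  | succ n ih =>
    have hv := A.isHarmonic_truncTime n
    have main : ∀ y ∉ S,
        0 ≤ A.truncTime (n + 1) (.ofFinset S) - A.truncTime (n + 1) ((ARWConfig.ofFinset S).add y) ∧
        A.truncTime (n + 1) (.ofFinset S) - A.truncTime (n + 1) ((ARWConfig.ofFinset S).add y) ≤
          A.trel := by
      intro y hy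
      have hS : S ≠ Finset.univ := fun h => hy (h ▸ Finset.mem_univ y)
      have hact := ARWConfig.activeOn_ofFinset S
      have e : A.ins (A.truncTime n) (.ofFinset S) -
          A.ins (A.truncTime n) ((ARWConfig.ofFinset S).add y) =
          (1 - ∑ z ∈ Sᶜ, A.growth S z) * (A.truncTime n (.ofFinset S) -
            A.truncTime n ((ARWConfig.ofFinset S).add y)) +
          ∑ z ∈ Sᶜ, A.growth S z * (A.truncTime n (.ofFinset (insert z S)) -
            A.truncTime n ((ARWConfig.ofFinset (insert z S)).add y)) := by
        rw [hv.ins_eq hact, hv.ins_eq (hact.add y)]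
        have : ∀ z ∈ Sᶜ, A.growth S z * (A.truncTime n (.ofFinset (insert z S)) -
            A.truncTime n ((ARWConfig.ofFinset (insert z S)).add y)) =
            A.growth S z * (A.truncTime n ((ARWConfig.ofFinset S).add z) -
            A.truncTime n (((ARWConfig.ofFinset S).add y).add z)) := fun z hz => by
          rw [ARWConfig.add_comm _ y z, ARWConfig.ofFinset_add (Finset.mem_compl.1 hz)]
        rw [Finset.sum_congr rfl this]
        simp only [mul_sub, Finset.sum_sub_distrib, ← Finset.sum_mul]
        ring
      have h1 := A.sum_growth_le_one S
      rw [truncTime_succ, truncTime_succ A n ((ARWConfig.ofFinset S).add y), add_sub_add_comm, e]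
      have e1 : A.truncTime 1 (.ofFinset S) - A.truncTime 1 ((ARWConfig.ofFinset S).add y) =
          if insert y S = Finset.univ then 1 else 0 := by
        rw [ARWConfig.ofFinset_add hy, truncTime_ofFinset, truncTime_ofFinset]
        simp only [Finset.sum_range_one, tail_zero, hS, if_false]
        split_ifs <;> ring
      rw [e1]
      split_ifs with hu
      · obtain rfl : S = Finset.univ.erase y := by rw [← hu, Finset.erase_insert hy]
        have hc : (Finset.univ.erase y)ᶜ = {y} := by simp
        have hx : A.truncTime n ((ARWConfig.ofFinset Finset.univ).add y) =
            A.truncTime n (.ofFinset Finset.univ) :=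
          hv.eq_ofFinset_univ ((ARWConfig.activeOn_ofFinset _).add y)
        rw [hc] at h1 ⊢
        simp only [Finset.sum_singleton, hu, hx, sub_self, mul_zero, add_zero] at h1 ⊢
        have h2 := A.one_le_trel_mul_growth y
        have h3 := ih (Finset.univ.erase y) y
        have h4 := mul_le_mul_of_nonneg_left h3.2 (sub_nonneg.2 h1)
        have h5 := mul_nonneg (sub_nonneg.2 h1) h3.1
        constructor <;> linarith
      · rw [zero_add]
        have h2 := mul_nonneg (sub_nonneg.2 h1) (ih S y).1
        have h3 := mul_le_mul_of_nonneg_left (ih S y).2 (sub_nonneg.2 h1)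
        have h4 := Finset.sum_nonneg fun z (_ : z ∈ Sᶜ) =>
          mul_nonneg (A.growth_nonneg S z) (ih (insert z S) y).1
        have h5 := Finset.sum_le_sum fun z (_ : z ∈ Sᶜ) =>
          mul_le_mul_of_nonneg_left (ih (insert z S) y).2 (A.growth_nonneg S z)
        rw [← Finset.sum_mul] at h5
        constructor <;> linarith
    have e : A.truncTime (n + 1) (.ofFinset S) -
        A.truncTime (n + 1) ((ARWConfig.ofFinset S).add y) =
        ∑ z ∈ Sᶜ, A.exitProb S z y * (A.truncTime (n + 1) (.ofFinset S) -
          A.truncTime (n + 1) ((ARWConfig.ofFinset S).add z)) := by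
      rw [(A.isHarmonic_truncTime (n + 1)).add_eq_exit (ARWConfig.activeOn_ofFinset S) y,
        sub_add_cancel_left, ← Finset.sum_neg_distrib]
      exact Finset.sum_congr rfl fun z _ => by ring
    rw [e]
    constructor
    · exact Finset.sum_nonneg fun z hz =>
        mul_nonneg (A.exitProb_nonneg S z y) (main z (Finset.mem_compl.1 hz)).1
    · refine (Finset.sum_le_sum fun z hz => mul_le_mul_of_nonneg_left
        (main z (Finset.mem_compl.1 hz)).2 (A.exitProb_nonneg S z y)).trans ?_
      rw [← Finset.sum_mul]
      exact mul_le_of_le_one_left hC (A.sum_exitProb_le_one S y)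

/-- The mean time for internal DLA started from `S` to fill `V`. -/
noncomputable def meanTime (A : ARWData V) (S : Finset V) : ℝ := ∑' t, A.tail t S

theorem meanTime_univ (A : ARWData V) : A.meanTime Finset.univ = 0 := by
  simp [meanTime, tail_univ]

theorem meanTime_nonneg (A : ARWData V) (S : Finset V) : 0 ≤ A.meanTime S :=
  tsum_nonneg fun t => (A.tail_mem_Icc t S).1

theorem meanTime_sub_insert (A : ARWData V) {S : Finset V} {y : V} (hy : y ∉ S) :
    0 ≤ A.meanTime S - A.meanTime (insert y S) ∧
      A.meanTime S - A.meanTime (insert y S) ≤ A.trel := by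
  have h := (A.summable_tail S).hasSum.tendsto_sum_nat.sub
    (A.summable_tail (insert y S)).hasSum.tendsto_sum_nat
  have key := fun n => A.truncTime_sub_add n S y
  simp only [ARWConfig.ofFinset_add hy, truncTime_ofFinset] at key
  exact ⟨ge_of_tendsto' h fun n => (key n).1, le_of_tendsto' h fun n => (key n).2⟩

theorem meanTime_eq (A : ARWData V) {S : Finset V} (hS : S ≠ Finset.univ) :
    A.meanTime S = 1 + A.idla A.meanTime S := by
  have h : HasSum (fun t => A.tail (t + 1) S) (A.idla A.meanTime S) := by
    simp only [tail_succ]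
    exact (A.summable_tail S).hasSum.add (hasSum_sum fun y _ =>
      ((A.summable_tail (insert y S)).hasSum.sub (A.summable_tail S).hasSum).mul_left _)
  rw [meanTime, (A.summable_tail S).tsum_eq_zero_add, h.tsum_eq, tail_zero, if_neg hS]

theorem sum_growth_mul_meanTime (A : ARWData V) {S : Finset V} (hS : S ≠ Finset.univ) :
    ∑ y ∈ Sᶜ, A.growth S y * (A.meanTime S - A.meanTime (insert y S)) = 1 := by
  have h := A.meanTime_eq hS
  have e : ∑ y ∈ Sᶜ, A.growth S y * (A.meanTime S - A.meanTime (insert y S)) =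
      -∑ y ∈ Sᶜ, A.growth S y * (A.meanTime (insert y S) - A.meanTime S) := by
    rw [← Finset.sum_neg_distrib]
    exact Finset.sum_congr rfl fun y _ => by ring
  rw [idla] at h
  linarith

theorem one_le_meanTime (A : ARWData V) {S : Finset V} (hS : S ≠ Finset.univ) :
    1 ≤ A.meanTime S := by
  rw [A.meanTime_eq hS]
  have := A.idla_mono (fun T => A.meanTime_nonneg T) S
  rw [A.idla_const 0 S] at this
  linarith

theorem meanTime_empty_le (A : ARWData V) {m : ℕ} (hm : A.tail m ∅ ≤ 1 / 2) :
    A.meanTime ∅ ≤ 2 * m := by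
  have key : ∀ t, ∀ S : Finset V, A.tail (t + m) S ≤ 1 / 2 * A.tail t S := by
    intro t
    induction t with
    | zero =>
      intro S
      rw [Nat.zero_add, tail_zero]
      split_ifs with h
      · rw [h, tail_univ, mul_zero]
      · rw [mul_one]
        exact (A.tail_le_tail_empty m S).trans hm
    | succ t ih =>
      intro S
      rw [Nat.add_right_comm, tail_succ, tail_succ, ← idla_const_mul]
      exact A.idla_mono ih S
  have hs := A.summable_tail ∅
  have h1 : A.meanTime ∅ = ∑ t ∈ Finset.range m, A.tail t ∅ + ∑' t, A.tail (t + m) ∅ :=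
    (hs.sum_add_tsum_nat_add m).symm
  have h2 : ∑ t ∈ Finset.range m, A.tail t ∅ ≤ m := by
    simpa using Finset.sum_le_sum fun t (_ : t ∈ Finset.range m) => (A.tail_mem_Icc t ∅).2
  have h3 : ∑' t, A.tail (t + m) ∅ ≤ 1 / 2 * A.meanTime ∅ := by
    rw [meanTime, ← tsum_mul_left]
    exact Summable.tsum_le_tsum (fun t => key t ∅) ((summable_nat_add_iff m).2 hs)
      (hs.mul_left _)
  linarith

/-! ### Concentration of the filling time -/

/-- An upper bound for the mean square of `T + a`, where `T` is the filling time of internal DLA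
started from `S`, obtained from `Var T ≤ trel * 𝔼 T`. -/
noncomputable def secondMoment (A : ARWData V) (a : ℝ) (S : Finset V) : ℝ :=
  A.trel * A.meanTime S + (A.meanTime S + a) ^ 2

theorem secondMoment_nonneg (A : ARWData V) (a : ℝ) (S : Finset V) : 0 ≤ A.secondMoment a S :=
  add_nonneg (mul_nonneg (zero_le_one.trans A.one_le_trel) (A.meanTime_nonneg S)) (sq_nonneg _)

/-- The quadratic variation accumulated in one step is at most `trel`, since the decrements of
`meanTime` lie in `[0, trel]` and have mean `1`. -/
theorem idla_secondMoment_le (A : ARWData V) (a : ℝ) {S : Finset V} (hS : S ≠ Finset.univ) :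
    A.idla (A.secondMoment (a + 1)) S ≤ A.secondMoment a S := by
  have h1 := A.sum_growth_mul_meanTime hS
  have h2 : ∑ y ∈ Sᶜ, A.growth S y * (A.secondMoment (a + 1) (insert y S) -
      A.secondMoment (a + 1) S) ≤ ∑ y ∈ Sᶜ, -(2 * (A.meanTime S + (a + 1))) *
        (A.growth S y * (A.meanTime S - A.meanTime (insert y S))) := by
    refine Finset.sum_le_sum fun y hy => ?_
    obtain ⟨h3, h4⟩ := A.meanTime_sub_insert (Finset.mem_compl.1 hy)
    have h5 := mul_nonneg (A.growth_nonneg S y) (mul_nonneg h3 (sub_nonneg.2 h4))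
    simp only [secondMoment]
    linarith
  rw [← Finset.mul_sum, h1] at h2
  rw [idla]
  simp only [secondMoment] at h2 ⊢
  linarith

theorem tail_mul_sq_le (A : ARWData V) (t : ℕ) (S : Finset V) (a : ℝ) (ha : 0 ≤ a + (t + 1)) :
    (a + (t + 1)) ^ 2 * A.tail t S ≤ A.secondMoment a S := by
  induction t generalizing S a with
  | zero =>
    rw [tail_zero]
    split_ifs with h
    · rw [mul_zero]
      exact A.secondMoment_nonneg a S
    · have h1 := A.one_le_meanTime h
      have h2 : 0 ≤ A.trel * A.meanTime S :=
        mul_nonneg (zero_le_one.trans A.one_le_trel) (A.meanTime_nonneg S)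
      rw [secondMoment]
      push_cast at ha ⊢
      have : (a + (0 + 1)) ^ 2 ≤ (A.meanTime S + a) ^ 2 := pow_le_pow_left₀ ha (by linarith) 2
      linarith
  | succ t ih =>
    by_cases hS : S = Finset.univ
    · rw [hS, tail_univ, mul_zero]
      exact A.secondMoment_nonneg a _
    · refine le_trans ?_ (A.idla_secondMoment_le a hS)
      rw [tail_succ, ← idla_const_mul]
      push_cast at ha ⊢
      refine A.idla_mono (fun T => ?_) S
      have := ih T (a + 1) (by linarith)
      rwa [show a + 1 + ((t : ℝ) + 1) = a + (t + 1 + 1) by ring] at this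

theorem one_sub_tail_mul_sq_le (A : ARWData V) (t : ℕ) (S : Finset V) (a : ℝ) (ha : a + t ≤ 0) :
    (a + t) ^ 2 * (1 - A.tail t S) ≤ A.secondMoment a S := by
  have huniv : ∀ (a : ℝ) (t : ℕ), a + t ≤ 0 →
      (a + t) ^ 2 * (1 - A.tail t Finset.univ) ≤ A.secondMoment a Finset.univ := by
    intro a t ha
    rw [tail_univ, secondMoment, meanTime_univ]
    have : (0 : ℝ) ≤ t := Nat.cast_nonneg t
    nlinarith
  induction t generalizing S a with
  | zero =>
    by_cases hS : S = Finset.univ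
    · rw [hS]
      exact huniv a 0 ha
    · rw [tail_zero, if_neg hS, sub_self, mul_zero]
      exact A.secondMoment_nonneg a S
  | succ t ih =>
    by_cases hS : S = Finset.univ
    · rw [hS]
      exact huniv a _ ha
    · refine le_trans ?_ (A.idla_secondMoment_le a hS)
      have e : 1 - A.tail (t + 1) S = A.idla (fun T => 1 - A.tail t T) S := by
        rw [tail_succ]
        simp only [idla, sub_sub_sub_cancel_left]
        rw [sub_add_eq_sub_sub, sub_eq_add_neg _ (∑ y ∈ Sᶜ, _), ← Finset.sum_neg_distrib]
        congr 1
        exact Finset.sum_congr rfl fun y _ => by ring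
      rw [e, ← idla_const_mul]
      push_cast at ha ⊢
      refine A.idla_mono (fun T => ?_) S
      have := ih T (a + 1) (by linarith)
      rwa [show a + 1 + (t : ℝ) = a + (t + 1) by ring] at this

/-! ### Mixing times -/

theorem dsep_antitone (A : ARWData V) : Antitone A.dsep := by
  simpa only [← funext A.dsep_eq] using A.tail_antitone ∅

theorem dsep_nonneg (A : ARWData V) (t : ℕ) : 0 ≤ A.dsep t := by
  rw [dsep_eq]
  exact (A.tail_mem_Icc t ∅).1

theorem dsep_le_one (A : ARWData V) (t : ℕ) : A.dsep t ≤ 1 := by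
  rw [dsep_eq]
  exact (A.tail_mem_Icc t ∅).2

theorem dsep_tsep_le (A : ARWData V) {ε : ℝ} (hε : 0 < ε) : A.dsep (A.tsep ε) ≤ ε := by
  obtain ⟨t, ht⟩ := (A.tendsto_dsep.eventually (gt_mem_nhds hε)).exists
  exact Nat.sInf_mem (s := {t | A.dsep t ≤ ε}) ⟨t, ht.le⟩

theorem tsep_le_iff (A : ARWData V) {ε : ℝ} (hε : 0 < ε) {t : ℕ} :
    A.tsep ε ≤ t ↔ A.dsep t ≤ ε :=
  ⟨fun h => (A.dsep_antitone h).trans (A.dsep_tsep_le hε), fun h => Nat.sInf_le h⟩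

theorem lt_tsep_iff (A : ARWData V) {ε : ℝ} (hε : 0 < ε) {t : ℕ} :
    t < A.tsep ε ↔ ε < A.dsep t := by
  rw [← not_le, A.tsep_le_iff hε, not_le]

theorem tsep_anti (A : ARWData V) {ε δ : ℝ} (hε : 0 < ε) (h : ε ≤ δ) : A.tsep δ ≤ A.tsep ε :=
  (A.tsep_le_iff (hε.trans_le h)).2 ((A.dsep_tsep_le hε).trans h)

theorem card_le_tsep (A : ARWData V) : Fintype.card V ≤ A.tsep (1 / 2) := by
  by_contra! h
  have h1 := A.dsep_tsep_le (ε := 1 / 2) (by norm_num)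
  rw [dsep_eq, A.tail_eq_one _ (by simpa using h)] at h1
  norm_num at h1

/-- Chebyshev's inequality for the filling time, on both sides of its mean. -/
theorem tsep_sub_le (A : ARWData V) {ε : ℝ} (h0 : 0 < ε) (h1 : ε < 1 / 2) :
    (A.tsep ε : ℝ) - (A.tsep (1 - ε) : ℝ)
      ≤ Real.sqrt (8 * A.trel * (A.tsep (1 / 2) : ℝ) / ε) := by
  have hC := zero_le_one.trans A.one_le_trel
  set h := A.meanTime ∅ with hh
  have hn : 0 ≤ h := A.meanTime_nonneg ∅
  set δ := Real.sqrt (A.trel * h / ε) with hδ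
  have hδ0 : 0 ≤ δ := Real.sqrt_nonneg _
  have hq : 0 ≤ A.trel * h / ε := div_nonneg (mul_nonneg hC hn) h0.le
  have hδ2 : ε * δ ^ 2 = A.trel * h := by
    rw [hδ, Real.sq_sqrt hq]
    field_simp
  have hW : A.secondMoment (-h) ∅ = A.trel * h := by
    rw [secondMoment, ← hh]
    ring
  have up : (A.tsep ε : ℝ) ≤ h + δ := by
    by_contra! hc
    have hlt : ⌊h + δ⌋₊ < A.tsep ε := (Nat.floor_lt (by linarith)).2 hc
    have h2 := Nat.lt_floor_add_one (h + δ)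
    have h3 := A.tail_mul_sq_le ⌊h + δ⌋₊ ∅ (-h) (by linarith)
    rw [A.lt_tsep_iff h0, dsep_eq] at hlt
    rw [hW, ← hδ2] at h3
    have h4 : δ ^ 2 < (-h + (⌊h + δ⌋₊ + 1)) ^ 2 := pow_lt_pow_left₀ (by linarith) hδ0 (by norm_num)
    have h5 : 0 < (-h + ((⌊h + δ⌋₊ : ℝ) + 1)) ^ 2 := (sq_nonneg δ).trans_lt h4
    nlinarith
  have low : h - δ ≤ (A.tsep (1 - ε) : ℝ) := by
    by_contra! hc
    have h2 := A.one_sub_tail_mul_sq_le (A.tsep (1 - ε)) ∅ (-h) (by linarith)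
    have h3 := A.dsep_tsep_le (ε := 1 - ε) (by linarith)
    rw [dsep_eq] at h3
    rw [hW, ← hδ2] at h2
    have h4 : δ ^ 2 < (h - A.tsep (1 - ε)) ^ 2 :=
      pow_lt_pow_left₀ (by linarith) hδ0 (by norm_num)
    nlinarith
  have hm : h ≤ 2 * (A.tsep (1 / 2) : ℝ) := by
    refine A.meanTime_empty_le ?_
    rw [← dsep_eq]
    exact A.dsep_tsep_le (by norm_num)
  refine le_trans (b := 2 * δ) (by linarith) (Real.le_sqrt_of_sq_le ?_)
  rw [mul_pow, hδ, Real.sq_sqrt hq, mul_div_assoc', div_le_div_iff_of_pos_right h0]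
  nlinarith [mul_le_mul_of_nonneg_left hm hC]

theorem tsep_half_pos (A : ARWData V) : 0 < (A.tsep (1 / 2) : ℝ) := by
  have := A.nonempty
  exact_mod_cast Fintype.card_pos.trans_le A.card_le_tsep

theorem tsep_sub_lt (A : ARWData V) {ε κ : ℝ} (h0 : 0 < ε) (h1 : ε < 1 / 2) (hκ : 0 < κ)
    (h : A.trel / (A.tsep (1 / 2) : ℝ) < ε * κ ^ 2 / 8) :
    (A.tsep ε : ℝ) - (A.tsep (1 - ε) : ℝ) < κ * A.tsep (1 / 2) := by
  have ht := A.tsep_half_pos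
  refine (A.tsep_sub_le h0 h1).trans_lt ?_
  rw [Real.sqrt_lt' (mul_pos hκ ht), div_lt_iff₀ h0]
  rw [div_lt_iff₀ ht] at h
  nlinarith [mul_lt_mul_of_pos_right h ht]

/-- The spectral lower bound on the separation distance, in exponential form. -/
theorem exp_le_dsep (A : ARWData V) {η : ℝ} (hη : 0 < η)
    (h1 : 2 ≤ η * A.tsep (1 / 2)) (h2 : η * A.tsep (1 / 2) ≤ A.trel) :
    Real.exp (-(4 / η)) ≤ A.dsep (2 * A.tsep (1 / 2)) := by
  have ht := A.tsep_half_pos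
  set t : ℝ := ((A.tsep (1 / 2) : ℕ) : ℝ)
  have hr : 0 < 1 - A.rho := by linarith [A.rho_lt_one]
  have hC : A.trel * (1 - A.rho) = 1 := by
    rw [trel]
    field_simp
  have hC2 : 2 ≤ A.trel := h1.trans h2
  have hrho : 0 < A.rho := by nlinarith
  refine le_trans ?_ (A.rho_pow_le_dsep _)
  rw [← Real.exp_log (pow_pos hrho _), Real.log_pow]
  refine Real.exp_le_exp.2 ?_
  push_cast
  have hlog := Real.one_sub_inv_le_log_of_pos hrho
  have h3 : -(2 / (η * t)) ≤ 1 - A.rho⁻¹ := by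
    have e : 1 - A.rho⁻¹ = -((1 - A.rho) / A.rho) := by
      field_simp
      ring
    rw [e, neg_le_neg_iff, div_le_div_iff₀ hrho (mul_pos hη ht)]
    nlinarith [mul_le_mul_of_nonneg_right h2 hr.le]
  have h4 : (2 * t) * -(2 / (η * t)) = -(4 / η) := by
    field_simp
    norm_num
  rw [← h4]
  exact mul_le_mul_of_nonneg_left (h3.trans hlog) (by linarith)

end ARWData

/-! ### Cutoff -/

section Sequences

variable {V : ℕ → Type*} [∀ n, Fintype (V n)] [∀ n, DecidableEq (V n)]

theorem ProductCondition.separationCutoff {A : ∀ n, ARWData (V n)} (h : ProductCondition A) :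
    SeparationCutoff A := by
  have key : ∀ ε κ : ℝ, 0 < ε → ε < 1 / 2 → 0 < κ → ∀ᶠ n in atTop,
      ((A n).tsep ε : ℝ) - ((A n).tsep (1 - ε) : ℝ) < κ * (A n).tsep (1 / 2) :=
    fun ε κ h0 h1 hκ => (h.eventually (gt_mem_nhds (by positivity : 0 < ε * κ ^ 2 / 8))).mono
      fun n hn => (A n).tsep_sub_lt h0 h1 hκ hn
  refine fun α hα => ⟨fun h1 => ?_, fun h1 => ?_⟩
  · rw [Metric.tendsto_nhds]
    intro ε hε
    set δ := min ε (1 / 4) with hδ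
    have hδ0 : 0 < δ := lt_min hε (by norm_num)
    have hδ1 : δ < 1 / 2 := (min_le_right _ _).trans_lt (by norm_num)
    filter_upwards [key δ (1 - α) hδ0 hδ1 (by linarith)] with n hn
    have h2 : ((A n).tsep (1 / 2) : ℝ) ≤ (A n).tsep δ := by
      exact_mod_cast (A n).tsep_anti hδ0 hδ1.le
    have h3 : ⌊α * ((A n).tsep (1 / 2) : ℝ)⌋₊ < (A n).tsep (1 - δ) :=
      (Nat.floor_lt (by positivity)).2 (by linarith)
    rw [(A n).lt_tsep_iff (by linarith)] at h3
    have h4 := (A n).dsep_le_one ⌊α * ((A n).tsep (1 / 2) : ℝ)⌋₊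
    rw [Real.dist_eq, abs_sub_comm, abs_of_nonneg (by linarith)]
    linarith [min_le_left ε (1 / 4)]
  · rw [Metric.tendsto_nhds]
    intro ε hε
    set δ := min (ε / 2) (1 / 4) with hδ
    have hδ0 : 0 < δ := lt_min (by linarith) (by norm_num)
    have hδ1 : δ < 1 / 2 := (min_le_right _ _).trans_lt (by norm_num)
    filter_upwards [key δ (α - 1) hδ0 hδ1 (by linarith)] with n hn
    have h2 : ((A n).tsep (1 - δ) : ℝ) ≤ (A n).tsep (1 / 2) := by
      exact_mod_cast (A n).tsep_anti (by norm_num) (by linarith)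
    have h3 : (A n).tsep δ ≤ ⌊α * ((A n).tsep (1 / 2) : ℝ)⌋₊ := Nat.le_floor (by linarith)
    rw [(A n).tsep_le_iff hδ0] at h3
    rw [Real.dist_eq, sub_zero, abs_of_nonneg ((A n).dsep_nonneg _)]
    linarith [min_le_left (ε / 2) (1 / 4)]

theorem SeparationCutoff.productCondition {A : ∀ n, ARWData (V n)} (h : SeparationCutoff A)
    (ht : Tendsto (fun n => (A n).tsep (1 / 2)) atTop atTop) : ProductCondition A := by
  have h2 := (h 2 (by norm_num)).2 (by norm_num)
  rw [ProductCondition, Metric.tendsto_nhds]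
  intro η hη
  have ht' : Tendsto (fun n => η * ((A n).tsep (1 / 2) : ℝ)) atTop atTop :=
    (tendsto_natCast_atTop_atTop.comp ht).const_mul_atTop hη
  filter_upwards [h2.eventually (gt_mem_nhds (Real.exp_pos (-(4 / η)))),
    ht'.eventually_ge_atTop 2] with n hn hn'
  have hpos := (A n).tsep_half_pos
  rw [Real.dist_eq, sub_zero, abs_of_nonneg (div_nonneg
    (zero_le_one.trans (A n).one_le_trel) hpos.le), div_lt_iff₀ hpos]
  by_contra! hc
  have hf : ⌊(2 : ℝ) * ((A n).tsep (1 / 2) : ℝ)⌋₊ = 2 * (A n).tsep (1 / 2) := by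
    exact_mod_cast Nat.floor_natCast (R := ℝ) (2 * (A n).tsep (1 / 2))
  rw [hf] at hn
  exact absurd ((A n).exp_le_dsep hη hn' hc) (not_le.2 hn)

end Sequences

theorem mainTheorem2 :
    (∀ (V : Type*) [Fintype V] [DecidableEq V] (A : ARWData V),
      -- the chain and the quantities below are well defined
      ((∀ η ξ, 0 ≤ A.P η ξ) ∧ (∀ η, ∑ ξ, A.P η ξ = 1) ∧
        (∃! π, A.IsInvariant π) ∧ (∀ η, 0 < A.stat η) ∧
        Tendsto A.dsep atTop (𝓝 0) ∧ IsGreatest A.eigModuli A.rho ∧ A.rho < 1) ∧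
      -- the mixing window
      ∀ ε : ℝ, 0 < ε → ε < 1 / 2 →
        (A.tsep ε : ℝ) - (A.tsep (1 - ε) : ℝ)
          ≤ Real.sqrt (8 * A.trel * (A.tsep (1 / 2) : ℝ) / ε)) ∧
    (∀ (V : ℕ → Type*) [∀ n, Fintype (V n)] [∀ n, DecidableEq (V n)]
        (A : ∀ n, ARWData (V n)),
      (ProductCondition A → SeparationCutoff A) ∧
      (Tendsto (fun n => (A n).tsep (1 / 2)) atTop atTop →
        (SeparationCutoff A ↔ ProductCondition A)) ∧
      (Tendsto (fun n => Fintype.card (V n)) atTop atTop →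
        (SeparationCutoff A ↔ ProductCondition A))) := by
  refine ⟨fun V _ _ A => ⟨⟨A.P_nonneg, A.P_sum, A.existsUnique_isInvariant, A.stat_pos,
    A.tendsto_dsep, A.isGreatest_rho, A.rho_lt_one⟩, fun ε h0 h1 => A.tsep_sub_le h0 h1⟩,
    fun V _ _ A => ⟨fun h => h.separationCutoff,
      fun ht => ⟨fun h => h.productCondition ht, fun h => h.separationCutoff⟩,
      fun hc => ⟨fun h => h.productCondition (tendsto_atTop_mono (fun n => (A n).card_le_tsep) hc),
        fun h => h.separationCutoff⟩⟩⟩
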